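/- Let $\mathbb S^3$ be the unit sphere of $\mathbb R^4=\mathbb R^3\times\mathbb R$, with poles $\pm e_4$, where $e_4=(0,1)$, and let $\mathbb S^2=\{(y,s)\in\mathbb S^3 : s=0\}$. Let $\pi:\mathbb S^3\setminus\{\pm e_4\}\to\mathbb S^2$, $\pi(y,s)=(y/\|y\|,0)$ (in the stereographic projection from $e_4$ this is the radial projection $q\mapsto q/\|q\|$ of $\mathbb R^3\setminus\{0\}$ onto the unit sphere), and let $\rho(y,s)=(-s\,y/\|y\|,\|y\|)$ be the unit vector tangent to the fibre of $\pi$. Let $n\ge 1$, and let $D=\mathbb S^2\setminus\bigcup_{i=1}^n\Delta_i$ be a spherical billiard with $n$ circular obstacles: the $\Delta_i$ are open disks of $\mathbb S^2$, with centres $c_i$ and radii $r_i\in(0,\pi/2)$ for the spherical distance, whose closures are pairwise disjoint. Then there exists a smooth closed connected orientable embedded surface $\Sigma\subset\mathbb S^3\setminus\{\pm e_4\}$ of genus $n-1$ such that $\pi(\Sigma)=D$ and: 1. (Transversality to the fibres of the projection.) For all $x\in\Sigma$, if $\pi(x)\notin\partial D$, then $\rho(x)\notin T_x\Sigma$. 2.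 (Nonzero vertical principal curvature.) For all $x\in\Sigma$, if $\pi(x)\in\partial D$, then $\rho(x)\in T_x\Sigma$ and $\mathrm{II}_x(\rho(x))\neq 0$, where $\mathrm{II}$ is the second fundamental form of $\Sigma$ in $\mathbb S^3$ (with respect to a unit normal). 3. (Symmetry.) For all $i$, $\partial\Delta_i\subseteq\Sigma$; moreover, there is a neighbourhood of $\partial\Delta_i$ in $\Sigma$ which is invariant by the inversion $(y,s)\mapsto(y,-s)$ with respect to $\mathbb S^2$, and by all rotations of $\mathbb S^3$ around the great circle through $c_i$ and the poles. Here $\partial D$ and $\partial \Delta_i$ are the boundaries in $\mathbb S^2$. -/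

import Mathlib

open Set Filter Topology
open scoped ContDiff RealInnerProductSpace

/-- The Euclidean space `ℝ⁴`, in which `𝕊³` is the unit sphere. -/
abbrev E4 : Type := EuclideanSpace ℝ (Fin 4)

noncomputable section

/-- The unit sphere `𝕊³ ⊆ ℝ⁴`. -/
def sphereThree : Set E4 := Metric.sphere 0 1

/-- The great sphere `𝕊²` of `𝕊³`, given by the vanishing of the last coordinate. -/
def sphereTwo : Set E4 := {x | x ∈ sphereThree ∧ x 3 = 0}

/-- The pole `(0, 0, 0, 1)` of `𝕊³`. The two poles `±pole` are the points which correspond to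
infinity and to the origin in the stereographic projection `x ↦ (x₀, x₁, x₂) / (1 - x₃)`. -/
def pole : E4 := EuclideanSpace.single 3 1

/-- The component `(x₀, x₁, x₂, 0)` of `x`. On `𝕊³`, it vanishes exactly at the two poles. -/
def horizontal (x : E4) : E4 := x - x 3 • pole

/-- The natural projection `π` of `𝕊³` minus the poles onto `𝕊²`. In stereographic coordinates, it
is the radial projection `q ↦ q / ‖q‖` of `ℝ³ ∖ {0}` onto the unit sphere. -/
def sphereProj (x : E4) : E4 := ‖horizontal x‖⁻¹ • horizontal x

/-- The unit vector `ρ` tangent to the fibre of `π` (a half great circle joining the poles,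
that is, an open ray from the origin in stereographic coordinates) at a point `x` of `𝕊³` minus the
poles, pointing towards `pole` (outwards in stereographic coordinates). -/
def radialVector (x : E4) : E4 := ‖horizontal x‖ • pole - x 3 • sphereProj x

/-- The inversion of `𝕊³` with respect to `𝕊²`: the reflection `x₃ ↦ -x₃`, which is
`q ↦ q / ‖q‖ ^ 2` in stereographic coordinates. -/
def sphereInversion (x : E4) : E4 := x - (2 * x 3) • pole

/-- Rotations of `𝕊³` around the axis `(0, c)`, where `c ∈ 𝕊²`: the orientation-preserving linear
isometries which fix the great circle through the poles and `c` pointwise. In stereographic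
coordinates, these are the rotations of `ℝ³` around the line through the origin and `c`. -/
def IsRotationAround (c : E4) (R : E4 ≃ₗᵢ[ℝ] E4) : Prop :=
  R pole = pole ∧ R c = c ∧ LinearMap.det (R.toLinearEquiv : E4 →ₗ[ℝ] E4) = 1

/-- The open disk in `𝕊²` with centre `c` and radius `r` for the spherical distance. -/
def sphericalDisk (c : E4) (r : ℝ) : Set E4 :=
  {x | x ∈ sphereTwo ∧ InnerProductGeometry.angle x c < r}

/-- The topological boundary, relative to `𝕊²`, of a subset of `𝕊²`. -/
def boundaryInSphereTwo (A : Set E4) : Set E4 := closure A ∩ closure (sphereTwo \ A)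

/-- A spherical billiard with `n` circular obstacles: `n` open disks of radii in `(0, π / 2)` on
`𝕊²`, whose closures are pairwise disjoint. -/
structure SphericalBilliard (n : ℕ) where
  center : Fin n → E4
  radius : Fin n → ℝ
  center_mem : ∀ i, center i ∈ sphereTwo
  radius_pos : ∀ i, 0 < radius i
  radius_lt : ∀ i, radius i < Real.pi / 2
  disjoint_closures : ∀ i j, i ≠ j →
    Disjoint (closure (sphericalDisk (center i) (radius i)))
      (closure (sphericalDisk (center j) (radius j)))

/-- The obstacle `Δᵢ`. -/
def SphericalBilliard.obstacle {n : ℕ} (B : SphericalBilliard n) (i : Fin n) : Set E4 :=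
  sphericalDisk (B.center i) (B.radius i)

/-- The billiard table `D = 𝕊² ∖ ⋃ Δᵢ`. -/
def SphericalBilliard.domain {n : ℕ} (B : SphericalBilliard n) : Set E4 :=
  sphereTwo \ ⋃ i, B.obstacle i

/-- `S` is a smooth embedded surface without boundary in `𝕊³`: near each of its points, it is the
zero set in `𝕊³` of a smooth function whose differential does not vanish on the tangent space
of `𝕊³`. -/
def IsSmoothSurface (S : Set E4) : Prop :=
  S ⊆ sphereThree ∧
  ∀ x ∈ S, ∃ (U : Set E4) (f : E4 → ℝ), IsOpen U ∧ x ∈ U ∧ ContDiffOn ℝ ∞ f U ∧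
    S ∩ U = {y | y ∈ sphereThree ∧ y ∈ U ∧ f y = 0} ∧
    ∃ v : E4, ⟪x, v⟫ = 0 ∧ fderiv ℝ f x v ≠ 0

/-- `γ` is, near time `0`, a smooth curve in `S`, which passes through `x` with velocity `v` at
time `0`. -/
def IsCurveThrough (S : Set E4) (x v : E4) (γ : ℝ → E4) : Prop :=
  ContDiffAt ℝ ∞ γ 0 ∧ (∀ᶠ t in 𝓝 (0 : ℝ), γ t ∈ S) ∧ γ 0 = x ∧ deriv γ 0 = v

/-- The tangent space `T_x S`, as a set of vectors of `ℝ⁴`. -/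
def tangentSpaceAt (S : Set E4) (x : E4) : Set E4 := {v | ∃ γ : ℝ → E4, IsCurveThrough S x v γ}

/-- `N` is a unit vector of `T_x 𝕊³`, normal to `S` at `x`. -/
def IsUnitNormal (S : Set E4) (x N : E4) : Prop :=
  ‖N‖ = 1 ∧ ⟪x, N⟫ = 0 ∧ ∀ v ∈ tangentSpaceAt S x, ⟪v, N⟫ = 0

/-- The vector `v` is tangent to `S` at `x`, and `II_x(v) = k`, where `II` is the second fundamental
form of the surface `S` of `𝕊³` with respect to the unit normal `N`: the number `k` is the component
along `N` of the acceleration of any curve in `S` with velocity `v` at `x`. (The acceleration in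
`ℝ⁴` and the covariant derivative in `𝕊³` differ by a multiple of `x`, which is orthogonal to
`N`.) -/
def HasSecondFundamentalForm (S : Set E4) (x N v : E4) (k : ℝ) : Prop :=
  v ∈ tangentSpaceAt S x ∧ ∀ γ : ℝ → E4, IsCurveThrough S x v γ → ⟪deriv (deriv γ) 0, N⟫ = k

/-- The standard closed orientable surface of genus `g` in `ℝ³` (the surface of a doughnut with `g`
holes): it is the surface `z² = P(x, y)`, where `P` is positive on the open disk of radius `4 g + 1`
around the origin deprived of the `g` disjoint closed unit disks centred at `(4 k, 0)`,
`0 ≤ k < g`, vanishes (with nonzero differential) on the `g + 1` boundary circles, and is negative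
elsewhere. -/
def standardSurface (g : ℕ) : Set (ℝ × ℝ × ℝ) :=
  {p | p.2.2 ^ 2 = ((4 * (g : ℝ) + 1) ^ 2 - p.1 ^ 2 - p.2.1 ^ 2) *
    ∏ k ∈ Finset.range g, ((p.1 - 4 * (k : ℝ)) ^ 2 + p.2.1 ^ 2 - 1)}

/-- `S` is a closed connected orientable surface of genus `g`: it is homeomorphic to the standard
one. -/
def HasGenus (S : Set E4) (g : ℕ) : Prop := Nonempty (S ≃ₜ standardSurface g)

/-- Transversality to the fibres of the projection, away from the boundary of the billiard. -/
def SphericalBilliard.Transversality {n : ℕ} (B : SphericalBilliard n) (S : Set E4) : Prop :=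
  ∀ x ∈ S, sphereProj x ∉ boundaryInSphereTwo B.domain → radialVector x ∉ tangentSpaceAt S x

/-- Nonzero vertical principal curvature over the boundary of the billiard. (The unit normal is
unique up to sign.) -/
def SphericalBilliard.NonzeroVerticalCurvature {n : ℕ} (B : SphericalBilliard n) (S : Set E4) :
    Prop :=
  ∀ x ∈ S, sphereProj x ∈ boundaryInSphereTwo B.domain →
    ∃ N k, IsUnitNormal S x N ∧ HasSecondFundamentalForm S x N (radialVector x) k ∧ k ≠ 0

/-- Symmetry: `S` contains the boundary of each obstacle, which has a neighbourhood `V` in `S` that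
is invariant by inversion with respect to `𝕊²` and by rotation around the axis through the centre
of the obstacle. -/
def SphericalBilliard.Symmetry {n : ℕ} (B : SphericalBilliard n) (S : Set E4) : Prop :=
  ∀ i, boundaryInSphereTwo (B.obstacle i) ⊆ S ∧
    ∃ V : Set E4, V ⊆ S ∧
      (∃ U : Set E4, IsOpen U ∧ boundaryInSphereTwo (B.obstacle i) ⊆ U ∧ U ∩ S ⊆ V) ∧
      sphereInversion '' V = V ∧
      ∀ R : E4 ≃ₗᵢ[ℝ] E4, IsRotationAround (B.center i) R → R '' V = V

end

/-! The surface is the double of the table. The fibre of the projection over `z` in the great sphere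
is parametrised by a slope `t` (`fiberPoint`), and the surface consists of the points with `t ^ 2 =
P z`, where `P` (`tableFunction`) is smooth, positive in the interior of the table, zero on its
boundary and negative on the obstacles. Equivalently, `x 3 ^ 2 = ‖horizontal x‖ ^ 2 * P (sphereProj
x)`.

Off the boundary `x 3 ≠ 0`, and the derivative of this equation along the fibre is `2 * x 3 *
‖horizontal x‖ * (1 + P)`, which is nonzero: this gives both smoothness and transversality. Near the
boundary of the obstacle with centre `c` and height `a = cos r`, `P` is chosen to be `a ^ 2 - ⟪z, c⟫
^ 2`. The surface is then the quadric `⟪x, c⟫ ^ 2 + (1 + a ^ 2) * x 3 ^ 2 = a ^ 2` of the 3-sphere.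
It involves only `⟪x, c⟫` and `x 3 ^ 2`, whence the symmetries; differentiating it twice along a
curve gives the vertical curvature explicitly.

For the genus, stereographic projection from the centre of one obstacle turns the table into a disk
with `n - 1` round holes, and the surface into the double `t ^ 2 = A w` of this planar domain. The
standard surface is also such a double. A homeomorphism of the plane matching the two domains and
their boundaries lifts to the doubles (`doubleHomeomorph`), so it suffices that any two disks with
equally many round holes are matched in this way (`CircleDomain.equivalent`). After shrinking the
holes, this amounts to moving finitely many points by a compactly supported homeomorphism
(`pushesTo_of_injective`). Nearby configurations are related by a small perturbation of the
identity. Distant ones are joined through affine interpolation with complex time: collisions occur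
at countably many times only, and the complement of a countable set in the plane is connected. -/

/-! ### Moving points in the plane by compactly supported homeomorphisms -/

/-- A perturbation of the identity by a contraction is a homeomorphism. -/
lemma exists_homeomorph_add_of_contracting (u : ℂ → ℂ) (K : NNReal) (hK : K < 1)
    (hu : LipschitzWith K u) : ∃ h : ℂ ≃ₜ ℂ, ∀ z, h z = z + u z := by
  have hf : ApproximatesLinearOn (fun z => z + u z)
      ((ContinuousLinearEquiv.refl ℝ ℂ : ℂ ≃L[ℝ] ℂ) : ℂ →L[ℝ] ℂ) univ K := by
    intro z _ w _
    have := hu.dist_le_mul z w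
    rw [dist_eq_norm, dist_eq_norm] at this
    refine le_trans (le_of_eq (congrArg norm ?_)) this
    change z + u z - (w + u w) - (z - w) = _
    ring
  refine ⟨hf.toHomeomorph _ (Or.inr ?_), fun z => rfl⟩
  have : ‖(((ContinuousLinearEquiv.refl ℝ ℂ).symm : ℂ ≃L[ℝ] ℂ) : ℂ →L[ℝ] ℂ)‖₊ = 1 := by
    have : (((ContinuousLinearEquiv.refl ℝ ℂ).symm : ℂ ≃L[ℝ] ℂ) : ℂ →L[ℝ] ℂ) =
      ContinuousLinearMap.id ℝ ℂ := rfl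
    rw [this]
    exact ContinuousLinearMap.nnnorm_id
  rw [this]
  simpa using hK

/-- The trapezoidal function of `t`, equal to `1` for `t ≤ σ` and to `0` for `t ≥ 2 * σ`. -/
noncomputable def trapezoid (σ t : ℝ) : ℝ := max 0 (min 1 (2 - t / σ))

lemma trapezoid_eq_one {σ t : ℝ} (hσ : 0 < σ) (h : t ≤ σ) : trapezoid σ t = 1 := by
  have : t / σ ≤ 1 := (div_le_one hσ).2 h
  rw [trapezoid, min_eq_left (by linarith), max_eq_right zero_le_one]

lemma trapezoid_eq_zero {σ t : ℝ} (hσ : 0 < σ) (h : 2 * σ ≤ t) : trapezoid σ t = 0 := by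
  have : 2 ≤ t / σ := (le_div_iff₀ hσ).2 h
  rw [trapezoid, max_eq_left]
  exact (min_le_right _ _).trans (by linarith)

lemma abs_trapezoid_sub_le {σ : ℝ} (hσ : 0 < σ) (s t : ℝ) :
    |trapezoid σ s - trapezoid σ t| ≤ |s - t| / σ := by
  have h1 : |trapezoid σ s - trapezoid σ t| ≤ |s / σ - t / σ| := by
    unfold trapezoid
    generalize s / σ = a
    generalize t / σ = b
    have := abs_le.1 (le_refl |a - b|)
    simp only [max_def, min_def]
    split_ifs <;> rw [abs_le] <;> constructor <;> linarith [abs_nonneg (a - b)]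
  rwa [← sub_div, abs_div, abs_of_pos hσ] at h1

/-- There is a homeomorphism of the plane with compact support which is, near each point `p i`, the
translation which maps `p i` to `q i`. -/
def PushesTo {ι : Type*} (p q : ι → ℂ) : Prop :=
  ∃ (h : ℂ ≃ₜ ℂ) (R ε : ℝ), 0 < ε ∧ (∀ z, R ≤ ‖z‖ → h z = z) ∧
    ∀ i z, ‖z - p i‖ ≤ ε → h z = z + (q i - p i)

lemma PushesTo.symm {ι : Type*} {p q : ι → ℂ} (H : PushesTo p q) : PushesTo q p := by
  obtain ⟨h, R, ε, hε, hR, hh⟩ := H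
  refine ⟨h.symm, R, ε, hε, fun z hz => ?_, fun i z hz => ?_⟩
  · rw [Homeomorph.symm_apply_eq, hR z hz]
  · rw [Homeomorph.symm_apply_eq, hh i]
    · ring
    · convert hz using 2
      ring

lemma PushesTo.trans {ι : Type*} {p q r : ι → ℂ} (H : PushesTo p q) (H' : PushesTo q r) :
    PushesTo p r := by
  obtain ⟨h, R, ε, hε, hR, hh⟩ := H
  obtain ⟨h', R', ε', hε', hR', hh'⟩ := H'
  refine ⟨h.trans h', max R R', min ε ε', lt_min hε hε', fun z hz => ?_, fun i z hz => ?_⟩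
  · rw [Homeomorph.trans_apply, hR z ((le_max_left _ _).trans hz),
      hR' z ((le_max_right _ _).trans hz)]
  · rw [Homeomorph.trans_apply, hh i z (hz.trans (min_le_left _ _)), hh' i]
    · ring
    · refine le_trans (le_of_eq ?_) (hz.trans (min_le_right _ _))
      congr 1
      ring

/-- The factor `3` makes the disk of radius `σ` around a point disjoint from the open disks of
radius `2 * σ` around the others, so that the cutoffs centred at those vanish on it. -/
lemma exists_separation {ι : Type*} [Finite ι] {p : ι → ℂ} (hp : Function.Injective p) :
    ∃ σ > 0, ∀ i j, i ≠ j → 3 * σ ≤ ‖p i - p j‖ := by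
  have h1 : ∀ᶠ σ in 𝓝[>] (0 : ℝ), ∀ i j, i ≠ j → 3 * σ ≤ ‖p i - p j‖ := by
    refine eventually_all.2 fun i => eventually_all.2 fun j => ?_
    by_cases hij : i = j
    · simp [hij]
    · have : 0 < ‖p i - p j‖ := norm_pos_iff.2 (sub_ne_zero.2 fun h => hij (hp h))
      have h2 : ∀ᶠ σ in 𝓝[>] (0 : ℝ), σ < ‖p i - p j‖ / 3 :=
        nhdsWithin_le_nhds (eventually_lt_nhds (by positivity))
      filter_upwards [h2] with σ hσ _
      linarith
  obtain ⟨σ, h, hσ⟩ := (h1.and self_mem_nhdsWithin).exists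
  exact ⟨σ, hσ, h⟩

/-- Each displacement `q i - p i` is cut off near `p i`; when the displacements are small, their sum
is a contraction, and adding it to the identity gives a homeomorphism. -/
lemma exists_pushesTo_of_close {ι : Type*} [Fintype ι] {p : ι → ℂ} (hp : Function.Injective p) :
    ∃ η > 0, ∀ q : ι → ℂ, (∀ i, ‖q i - p i‖ ≤ η) → PushesTo p q := by
  obtain ⟨σ, hσ, hsep⟩ := exists_separation hp
  set N : ℝ := (Fintype.card ι : ℝ) with hN
  have hN0 : 0 ≤ N := Nat.cast_nonneg _
  -- Each cutoff is `1 / σ`-Lipschitz, so `N` displacements of this size give a total Lipschitz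
  -- constant below `1 / 2`.
  refine ⟨σ / (2 * (N + 1)), by positivity, fun q hq => ?_⟩
  set u : ℂ → ℂ := fun z => ∑ i, trapezoid σ ‖z - p i‖ • (q i - p i) with hu
  have hlip : LipschitzWith (1 / 2) u := by
    refine LipschitzWith.of_dist_le_mul fun z w => ?_
    rw [dist_eq_norm, dist_eq_norm, hu]
    simp only [← Finset.sum_sub_distrib, ← sub_smul]
    calc ‖∑ i, (trapezoid σ ‖z - p i‖ - trapezoid σ ‖w - p i‖) • (q i - p i)‖
        ≤ ∑ i : ι, ‖z - w‖ / σ * (σ / (2 * (N + 1))) := by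
          refine norm_sum_le_of_le _ fun i _ => ?_
          rw [norm_smul, Real.norm_eq_abs]
          refine mul_le_mul ((abs_trapezoid_sub_le hσ _ _).trans ?_) (hq i) (norm_nonneg _)
            (by positivity)
          gcongr
          refine (abs_norm_sub_norm_le _ _).trans (le_of_eq ?_)
          congr 1
          ring
      _ = (N / (N + 1)) * (1 / 2) * ‖z - w‖ := by
          rw [Finset.sum_const, Finset.card_univ, nsmul_eq_mul, ← hN]
          field_simp
      _ ≤ 1 * (1 / 2) * ‖z - w‖ := by
          gcongr
          exact (div_le_one (by positivity)).2 (by linarith)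
      _ = _ := by simp
  obtain ⟨h, hh⟩ := exists_homeomorph_add_of_contracting u (1 / 2)
    (by rw [← NNReal.coe_lt_coe]; norm_num) hlip
  -- Beyond this radius a point is at distance at least `2 * σ` from every `p i`.
  refine ⟨h, (∑ i, ‖p i‖) + 2 * σ, σ, hσ, fun z hz => ?_, fun i z hz => ?_⟩
  · rw [hh, add_eq_left, hu]
    refine Finset.sum_eq_zero fun i _ => ?_
    rw [trapezoid_eq_zero hσ, zero_smul]
    have h1 := Finset.single_le_sum (f := fun i => ‖p i‖) (fun j _ => norm_nonneg _)
      (Finset.mem_univ i)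
    have h2 := norm_sub_norm_le z (p i)
    linarith
  · rw [hh, hu]
    dsimp only
    rw [Finset.sum_eq_single i, trapezoid_eq_one hσ hz, one_smul]
    · intro j _ hj
      rw [trapezoid_eq_zero hσ, zero_smul]
      have h1 := hsep i j hj.symm
      have h2 := norm_sub_le_norm_sub_add_norm_sub (p i) z (p j)
      rw [norm_sub_rev (p i) z] at h2
      linarith
    · simp

/-- Any two configurations of points of the plane are related by a homeomorphism with compact
support, which can be taken to be a translation near each point. -/
theorem pushesTo_of_injective {ι : Type*} [Fintype ι] {p q : ι → ℂ} (hp : Function.Injective p)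
    (hq : Function.Injective q) : PushesTo p q := by
  -- Time is complex: the difference of two affine motions that start at distinct points vanishes at
  -- most once, so the set `T` of collision times is countable and its complement in `ℂ` is
  -- connected.
  set c : ℂ → ι → ℂ := fun t i => p i + t * (q i - p i) with hc
  have hcc : Continuous c := by fun_prop
  set T : Set ℂ := ⋃ i, ⋃ j, {t | i ≠ j ∧ c t i = c t j} with hT
  have hTc : T.Countable := by
    refine countable_iUnion fun i => countable_iUnion fun j => Set.Subsingleton.countable ?_
    rintro s ⟨hij, hs⟩ t ⟨-, ht⟩
    simp only [hc] at hs ht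
    by_contra hst
    have h1 : (s - t) * ((q i - p i) - (q j - p j)) = 0 := by linear_combination hs - ht
    rcases mul_eq_zero.1 h1 with h | h
    · exact hst (sub_eq_zero.1 h)
    · exact hij (hp (by linear_combination hs - s * h))
  have hinj : ∀ t ∈ Tᶜ, Function.Injective (c t) := by
    intro t ht i j hij
    by_contra h
    exact ht (mem_iUnion.2 ⟨i, mem_iUnion.2 ⟨j, h, hij⟩⟩)
  have hinj' : ∀ t, Function.Injective (c t) → t ∈ Tᶜ := by
    intro t ht h
    obtain ⟨i, h⟩ := mem_iUnion.1 h
    obtain ⟨j, h, h'⟩ := mem_iUnion.1 h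
    exact h (ht h')
  have hconn : IsPreconnected Tᶜ :=
    (hTc.isConnected_compl_of_one_lt_rank (by rw [Complex.rank_real_complex]; norm_num)).2
  have h0 : c 0 = p := by simp [hc]
  have h1 : c 1 = q := by simp [hc]
  rw [← h0, ← h1]
  -- A symmetric and transitive relation that holds locally on a connected set holds between any two
  -- of its points.
  refine hconn.induction₂ (fun s t => PushesTo (c s) (c t)) (fun s hs => ?_)
    (fun _ _ _ _ _ _ => PushesTo.trans) (fun _ _ _ _ => PushesTo.symm)
    (hinj' _ (by rwa [h0])) (hinj' _ (by rwa [h1]))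
  obtain ⟨η, hη, H⟩ := exists_pushesTo_of_close (hinj s hs)
  refine nhdsWithin_le_nhds ?_
  filter_upwards [hcc.continuousAt.preimage_mem_nhds (Metric.ball_mem_nhds (c s) hη)] with t ht
  refine H _ fun i => ?_
  rw [← dist_eq_norm]
  exact (dist_le_pi_dist _ _ i).trans (le_of_lt ht)

/-! ### Radial homeomorphisms of the plane -/

/-- The radial map with profile `φ`. -/
noncomputable def radialMap (φ : ℝ → ℝ) (z : ℂ) : ℂ := (φ ‖z‖ / ‖z‖) • z

lemma norm_radialMap {φ : ℝ → ℝ} (h0 : φ 0 = 0) (hφ : ∀ t, 0 ≤ t → 0 ≤ φ t) (z : ℂ) :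
    ‖radialMap φ z‖ = φ ‖z‖ := by
  rcases eq_or_ne z 0 with rfl | hz
  · simp [radialMap, h0]
  · have := norm_pos_iff.2 hz
    rw [radialMap, norm_smul, Real.norm_eq_abs,
      abs_of_nonneg (div_nonneg (hφ _ this.le) this.le)]
    field_simp

lemma continuous_radialMap {φ : ℝ → ℝ} (h0 : φ 0 = 0) (hφ : ∀ t, 0 ≤ t → 0 ≤ φ t)
    (hc : Continuous φ) : Continuous (radialMap φ) := by
  rw [continuous_iff_continuousAt]
  intro z
  rcases eq_or_ne z 0 with rfl | hz
  · have h1 : radialMap φ 0 = 0 := by simp [radialMap]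
    rw [ContinuousAt, h1, tendsto_zero_iff_norm_tendsto_zero]
    simp only [norm_radialMap h0 hφ]
    have : Continuous fun z : ℂ => φ ‖z‖ := by fun_prop
    simpa [h0] using this.tendsto 0
  · have := norm_ne_zero_iff.2 hz
    unfold radialMap
    fun_prop (disch := assumption)

lemma radialMap_radialMap {φ ψ : ℝ → ℝ} (h0 : φ 0 = 0) (hφ : ∀ t, 0 ≤ t → 0 ≤ φ t)
    (hφ' : ∀ t, 0 < t → 0 < φ t) (h : ∀ t, ψ (φ t) = t) (z : ℂ) :
    radialMap ψ (radialMap φ z) = z := by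
  rcases eq_or_ne z 0 with rfl | hz
  · simp [radialMap]
  · have h1 := norm_pos_iff.2 hz
    have h2 := hφ' _ h1
    rw [radialMap, norm_radialMap h0 hφ, h, radialMap, smul_smul]
    rw [div_mul_div_cancel₀ h2.ne', div_self h1.ne', one_smul]

/-- The inverse is the radial map whose profile is the inverse function of `φ`. -/
lemma exists_radial_homeomorph {φ : ℝ → ℝ} (h0 : φ 0 = 0) (hm : StrictMono φ) (hc : Continuous φ)
    (hs : Function.Surjective φ) :
    ∃ h : ℂ ≃ₜ ℂ, (∀ z, ‖h z‖ = φ ‖z‖) ∧ ∀ z, φ ‖z‖ = ‖z‖ → h z = z := by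
  set e : ℝ ≃o ℝ := hm.orderIsoOfSurjective φ hs with he
  have hφe : ∀ t, e t = φ t := fun t => rfl
  have hse : e.symm 0 = 0 := by rw [OrderIso.symm_apply_eq, hφe, h0]
  have hφ : ∀ t, 0 ≤ t → 0 ≤ φ t := fun t ht => by simpa [h0] using hm.monotone ht
  have hφ' : ∀ t, 0 < t → 0 < φ t := fun t ht => by simpa [h0] using hm ht
  have hψ : ∀ t, 0 ≤ t → 0 ≤ e.symm t := fun t ht => by
    simpa [hse] using e.symm.strictMono.monotone ht
  have hψ' : ∀ t, 0 < t → 0 < e.symm t := fun t ht => by simpa [hse] using e.symm.strictMono ht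
  refine ⟨⟨⟨radialMap φ, radialMap e.symm,
    radialMap_radialMap h0 hφ hφ' fun t => by rw [← hφe, e.symm_apply_apply],
    radialMap_radialMap hse hψ hψ' fun t => by rw [← hφe, e.apply_symm_apply]⟩,
    continuous_radialMap h0 hφ hc,
    continuous_radialMap hse hψ e.symm.continuous⟩, norm_radialMap h0 hφ, fun z hz => ?_⟩
  change radialMap φ z = z
  rcases eq_or_ne z 0 with rfl | hz0
  · simp [radialMap]
  · rw [radialMap, hz, div_self (norm_ne_zero_iff.2 hz0), one_smul]

/-- Shrinking a disk of radius `r` to radius `ε`, with support in the ball of radius `r + δ`. -/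
lemma exists_shrinking_homeomorph {r ε δ : ℝ} (hε : 0 < ε) (hr : ε ≤ r) (hδ : 0 < δ) :
    ∃ h : ℂ ≃ₜ ℂ, (∀ z, cmp ‖h z‖ ε = cmp ‖z‖ r) ∧ (∀ z, r + δ ≤ ‖z‖ → h z = z) ∧
      ∀ z, ‖z‖ < r + δ → ‖h z‖ < r + δ := by
  have hr0 : 0 < r := hε.trans_le hr
  -- Slope of the line through `(r, ε)` and `(r + δ, r + δ)`. On `t ≥ 0` the profile is linear from
  -- the origin up to `r`, then follows this line up to `r + δ`, where the minimum with `t` turns it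
  -- into the identity.
  set m := (r + δ - ε) / δ with hm
  have hm1 : 1 ≤ m := (one_le_div hδ).2 (by linarith)
  have hmδ : m * δ = r + δ - ε := by rw [hm]; field_simp
  have he1 : ε / r ≤ 1 := (div_le_one hr0).2 hr
  have he0 : 0 < ε / r := by positivity
  have her : ε / r * r = ε := by field_simp
  set k := ε / r with hk
  set φ : ℝ → ℝ := fun t => min t (max (k * t) (r + δ + m * (t - (r + δ)))) with hφ
  have hmono : StrictMono φ := by
    intro a b h
    refine min_lt_min h (max_lt_max (mul_lt_mul_of_pos_left h he0) ?_)
    have : m * (a - (r + δ)) < m * (b - (r + δ)) :=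
      mul_lt_mul_of_pos_left (by linarith) (by linarith)
    simpa using this
  have hcont : Continuous φ := by fun_prop
  have hr' : φ r = ε := by
    have h1 : r + δ + m * (r - (r + δ)) = ε := by linear_combination -hmδ
    simp only [hφ, h1, her, max_self]
    exact min_eq_right hr
  have hid : ∀ t, r + δ ≤ t → φ t = t := by
    intro t ht
    refine min_eq_left (le_trans ?_ (le_max_right _ _))
    nlinarith
  have hzero : φ 0 = 0 := by
    have : r + δ + m * (0 - (r + δ)) ≤ 0 := by nlinarith
    simp only [hφ, mul_zero, max_eq_left this, min_self]
  have hsurj : Function.Surjective φ := by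
    refine hcont.surjective (tendsto_id.congr' ?_)
      (tendsto_atBot_mono (fun t => min_le_left _ _) tendsto_id)
    filter_upwards [eventually_ge_atTop (r + δ)] with t ht
    exact (hid t ht).symm
  obtain ⟨h, h1, h2⟩ := exists_radial_homeomorph hzero hmono hcont hsurj
  refine ⟨h, fun z => ?_, fun z hz => h2 z (hid _ hz), fun z hz => ?_⟩
  · rw [h1, ← hr']
    exact hmono.cmp_map_eq _ _
  · rw [h1, ← hid (r + δ) le_rfl]
    exact hmono hz

/-- Enlarging the disk of radius `R` to radius `R'`, with support in the complement of the ball of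
radius `S < R`. -/
lemma exists_enlarging_homeomorph {S R R' : ℝ} (hS : 0 ≤ S) (hR : S < R) (hR' : R ≤ R') :
    ∃ h : ℂ ≃ₜ ℂ, (∀ z, cmp ‖h z‖ R' = cmp ‖z‖ R) ∧ (∀ z, ‖z‖ ≤ S → h z = z) ∧
      ∀ z, S < ‖z‖ → S < ‖h z‖ := by
  have hd : 0 < R - S := sub_pos.2 hR
  -- Slope of the line through `(S, S)` and `(R, R')`.
  set m := (R' - S) / (R - S) with hm
  have hm1 : 1 ≤ m := (one_le_div hd).2 (by linarith)
  have hmd : m * (R - S) = R' - S := by rw [hm]; field_simp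
  set φ : ℝ → ℝ := fun t => max t (S + m * (t - S)) with hφ
  have hmono : StrictMono φ := by
    intro a b h
    refine max_lt_max h ?_
    have : m * (a - S) < m * (b - S) := mul_lt_mul_of_pos_left (by linarith) (by linarith)
    simpa using this
  have hcont : Continuous φ := by fun_prop
  have hRR : φ R = R' := by
    simp only [hφ, hmd]
    rw [max_eq_right (by linarith)]
    ring
  have hid : ∀ t, t ≤ S → φ t = t := by
    intro t ht
    exact max_eq_left (by nlinarith)
  have hsurj : Function.Surjective φ := by
    refine hcont.surjective (tendsto_atTop_mono (fun t => le_max_left _ _) tendsto_id)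
      (tendsto_id.congr' ?_)
    filter_upwards [eventually_le_atBot S] with t ht
    exact (hid t ht).symm
  obtain ⟨h, h1, h2⟩ := exists_radial_homeomorph (hid 0 hS) hmono hcont hsurj
  refine ⟨h, fun z => ?_, fun z hz => h2 z (hid _ hz), fun z hz => ?_⟩
  · rw [h1, ← hRR]
    exact hmono.cmp_map_eq _ _
  · rw [h1, ← hid S le_rfl]
    exact hmono hz

/-! ### Disks with circular holes -/

/-- A disk around the origin of the plane, with round holes indexed by `ι`. -/
structure CircleDomain (ι : Type*) where
  outer : ℝ
  center : ι → ℂ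
  radius : ι → ℝ
  radius_pos : ∀ i, 0 < radius i
  separated : ∀ i j, i ≠ j → radius i + radius j < ‖center i - center j‖
  inside : ∀ i, ‖center i‖ + radius i < outer
  outer_pos : 0 < outer

namespace CircleDomain

variable {ι : Type*}

/-- There is a homeomorphism of the plane which maps each boundary circle of `C` and its interior to
the corresponding one of `C'`. -/
def Equivalent (C C' : CircleDomain ι) : Prop :=
  ∃ h : ℂ ≃ₜ ℂ, (∀ z, cmp ‖h z‖ C'.outer = cmp ‖z‖ C.outer) ∧
    ∀ i z, cmp ‖h z - C'.center i‖ (C'.radius i) = cmp ‖z - C.center i‖ (C.radius i)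

lemma Equivalent.refl (C : CircleDomain ι) : C.Equivalent C :=
  ⟨Homeomorph.refl ℂ, fun _ => rfl, fun _ _ => rfl⟩

lemma Equivalent.symm {C C' : CircleDomain ι} (H : C.Equivalent C') : C'.Equivalent C := by
  obtain ⟨h, h1, h2⟩ := H
  refine ⟨h.symm, fun z => ?_, fun i z => ?_⟩
  · rw [← h1, h.apply_symm_apply]
  · rw [← h2, h.apply_symm_apply]

lemma Equivalent.trans {C C' C'' : CircleDomain ι} (H : C.Equivalent C') (H' : C'.Equivalent C'') :
    C.Equivalent C'' := by
  obtain ⟨h, h1, h2⟩ := H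
  obtain ⟨h', h1', h2'⟩ := H'
  exact ⟨h.trans h', fun z => (h1' _).trans (h1 z), fun i z => (h2' i _).trans (h2 i z)⟩

/-- The circle domain with smaller holes. -/
def shrink (C : CircleDomain ι) (r : ι → ℝ) (hr : ∀ i, 0 < r i) (hle : ∀ i, r i ≤ C.radius i) :
    CircleDomain ι where
  outer := C.outer
  center := C.center
  radius := r
  radius_pos := hr
  separated i j h := (add_le_add (hle i) (hle j)).trans_lt (C.separated i j h)
  inside i := (add_le_add_right (hle i) _).trans_lt (C.inside i)
  outer_pos := C.outer_pos

/-- The circle domain with a larger outer radius. -/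
def enlarge (C : CircleDomain ι) (R : ℝ) (hR : C.outer ≤ R) : CircleDomain ι where
  outer := R
  center := C.center
  radius := C.radius
  radius_pos := C.radius_pos
  separated := C.separated
  inside i := (C.inside i).trans_le hR
  outer_pos := C.outer_pos.trans_le hR

/-- Used for the circles that a modification supported in `T` does not touch: `f` is the distance to
the centre of such a circle, and `T` lies entirely on one side of it. -/
lemma cmp_eq_of_local {f : ℂ → ℝ} {h : ℂ → ℂ} {r : ℝ} {T : Set ℂ} (h1 : ∀ z ∉ T, h z = z)
    (h2 : ∀ z ∈ T, h z ∈ T) (hf : (∀ z ∈ T, f z < r) ∨ ∀ z ∈ T, r < f z) (z : ℂ) :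
    cmp (f (h z)) r = cmp (f z) r := by
  by_cases hz : z ∈ T
  · rcases hf with hf | hf
    · rw [(hf z hz).cmp_eq_lt, (hf _ (h2 z hz)).cmp_eq_lt]
    · rw [(hf z hz).cmp_eq_gt, (hf _ (h2 z hz)).cmp_eq_gt]
  · rw [h1 z hz]

/-- The shrinking takes place in a slightly larger concentric disk, which by strict separation still
avoids the other holes and the outer circle. -/
lemma equivalent_shrink_single [Finite ι] (C : CircleDomain ι) (r : ι → ℝ) (hr : ∀ i, 0 < r i)
    (hle : ∀ i, r i ≤ C.radius i) (i : ι) (hi : ∀ j, j ≠ i → r j = C.radius j) :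
    C.Equivalent (C.shrink r hr hle) := by
  have hδ : ∃ δ > 0, ‖C.center i‖ + (C.radius i + δ) < C.outer ∧
      ∀ j, i ≠ j → (C.radius i + δ) + C.radius j < ‖C.center i - C.center j‖ := by
    have h1 : ∀ᶠ δ in 𝓝[>] (0 : ℝ), ‖C.center i‖ + (C.radius i + δ) < C.outer := by
      have : 0 < C.outer - (‖C.center i‖ + C.radius i) := sub_pos.2 (C.inside i)
      filter_upwards [nhdsWithin_le_nhds (eventually_lt_nhds this)] with δ h
      linarith
    have h2 : ∀ᶠ δ in 𝓝[>] (0 : ℝ), ∀ j, i ≠ j →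
        (C.radius i + δ) + C.radius j < ‖C.center i - C.center j‖ := by
      refine eventually_all.2 fun j => ?_
      by_cases hij : i = j
      · simp [hij]
      · have := sub_pos.2 (C.separated i j hij)
        filter_upwards [nhdsWithin_le_nhds (eventually_lt_nhds this)] with δ h _
        linarith
    obtain ⟨δ, ⟨h1, h2⟩, h3⟩ := ((h1.and h2).and self_mem_nhdsWithin).exists
    exact ⟨δ, h3, h1, h2⟩
  obtain ⟨δ, hδ, hout, hsep⟩ := hδ
  obtain ⟨k, k1, k2, k3⟩ := exists_shrinking_homeomorph (hr i) (hle i) hδ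
  set c := C.center i with hc
  set h : ℂ ≃ₜ ℂ := ((Homeomorph.subRight c).trans k).trans (Homeomorph.addRight c) with hh
  have hhz : ∀ z, h z = k (z - c) + c := fun z => rfl
  set T : Set ℂ := {z | ‖z - c‖ < C.radius i + δ} with hT
  have hT1 : ∀ z ∉ T, h z = z := by
    intro z hz
    rw [hhz, k2 _ (not_lt.1 hz), sub_add_cancel]
  have hT2 : ∀ z ∈ T, h z ∈ T := by
    intro z hz
    simp only [hT, mem_ofPred_eq, hhz, add_sub_cancel_right]
    exact k3 _ hz
  refine ⟨h, cmp_eq_of_local hT1 hT2 (Or.inl fun z hz => ?_), fun j z => ?_⟩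
  · simp only [hT, mem_ofPred_eq] at hz
    have := norm_le_norm_add_norm_sub' z c
    change ‖z‖ < C.outer
    linarith
  · change cmp ‖h z - C.center j‖ (r j) = _
    by_cases hij : j = i
    · subst hij
      rw [hhz, add_sub_cancel_right, k1]
    · rw [hi j hij]
      refine cmp_eq_of_local (f := fun z => ‖z - C.center j‖) hT1 hT2 (Or.inr fun w hw => ?_) z
      simp only [hT, mem_ofPred_eq] at hw
      have h1 := hsep j (Ne.symm hij)
      have h2 := norm_sub_le_norm_sub_add_norm_sub c w (C.center j)
      rw [norm_sub_rev c w] at h2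
      linarith

lemma equivalent_shrink [Fintype ι] (C : CircleDomain ι) (r : ι → ℝ) (hr : ∀ i, 0 < r i)
    (hle : ∀ i, r i ≤ C.radius i) : C.Equivalent (C.shrink r hr hle) := by
  classical
  have key : ∀ s : Finset ι, ∀ (r' : ι → ℝ) (hr' : ∀ i, 0 < r' i) (hle' : ∀ i, r' i ≤ C.radius i),
      (∀ i ∉ s, r' i = C.radius i) → C.Equivalent (C.shrink r' hr' hle') := by
    intro s
    induction s using Finset.induction_on with
    | empty =>
      intro r' hr' hle' h
      have : C = C.shrink r' hr' hle' := by
        have : r' = C.radius := funext fun i => h i (by simp)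
        subst this
        rfl
      rw [← this]
      exact .refl C
    | insert a s ha ih =>
      intro r' hr' hle' h
      -- The intermediate domain keeps hole `a` at its original size, so the induction hypothesis
      -- reaches it; hole `a` is shrunk last.
      have hu : ∀ i, 0 < Function.update r' a (C.radius a) i := by
        intro i
        rcases eq_or_ne i a with rfl | hi
        · simpa using C.radius_pos i
        · simpa [hi] using hr' i
      have hu' : ∀ i, Function.update r' a (C.radius a) i ≤ C.radius i := by
        intro i
        rcases eq_or_ne i a with rfl | hi
        · simp
        · simpa [hi] using hle' i
      have hu'' : ∀ i, r' i ≤ Function.update r' a (C.radius a) i := by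
        intro i
        rcases eq_or_ne i a with rfl | hi
        · simpa using hle' i
        · simp [hi]
      refine (ih _ hu hu' fun i hi => ?_).trans
        ((C.shrink _ hu hu').equivalent_shrink_single r' hr' hu'' a fun j hj => ?_)
      · rcases eq_or_ne i a with rfl | hia
        · simp
        · simpa [hia] using h i (by simp [hia, hi])
      · simp [shrink, hj]
  exact key Finset.univ r hr hle fun i hi => absurd (Finset.mem_univ i) hi

/-- The stretching is confined to the exterior of a disk of radius `S < C.outer` that contains all
the holes. -/
lemma equivalent_enlarge [Finite ι] (C : CircleDomain ι) (R : ℝ) (hR : C.outer ≤ R) :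
    C.Equivalent (C.enlarge R hR) := by
  obtain ⟨S, hS, hSR, hin⟩ : ∃ S, 0 ≤ S ∧ S < C.outer ∧ ∀ i, ‖C.center i‖ + C.radius i < S := by
    have h1 : ∀ᶠ S in 𝓝[<] C.outer, ∀ i, ‖C.center i‖ + C.radius i < S :=
      eventually_all.2 fun i => nhdsWithin_le_nhds (eventually_gt_nhds (C.inside i))
    have h2 : ∀ᶠ S in 𝓝[<] C.outer, 0 < S := nhdsWithin_le_nhds (eventually_gt_nhds C.outer_pos)
    obtain ⟨S, ⟨h1, h2⟩, h3⟩ := ((h1.and h2).and self_mem_nhdsWithin).exists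
    exact ⟨S, h2.le, h3, h1⟩
  obtain ⟨h, h1, h2, h3⟩ := exists_enlarging_homeomorph hS hSR hR
  refine ⟨h, h1, fun i z => ?_⟩
  refine cmp_eq_of_local (f := fun z => ‖z - C.center i‖) (T := {z | S < ‖z‖})
    (fun z hz => h2 z (not_lt.1 hz)) h3 (Or.inr fun z hz => ?_) z
  have := norm_le_norm_add_norm_sub' z (C.center i)
  have := hin i
  simp only [mem_ofPred_eq] at hz
  change C.radius i < ‖z - C.center i‖
  linarith

/-- Each hole lies in a disk on which `h` is a translation, so it is carried onto the new hole.
Since that image is already covered, injectivity keeps the points outside the hole outside; the same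
argument applies to the outer circle, beyond which `h` is the identity. -/
lemma equivalent_of_pushesTo {C C' : CircleDomain ι} {h : ℂ ≃ₜ ℂ} {R ε : ℝ}
    (hR : ∀ z, R ≤ ‖z‖ → h z = z)
    (hε : ∀ i z, ‖z - C.center i‖ ≤ ε → h z = z + (C'.center i - C.center i))
    (ho : R ≤ C.outer) (ho' : C'.outer = C.outer) (hr : ∀ i, C.radius i ≤ ε)
    (hr' : ∀ i, C'.radius i = C.radius i) : C.Equivalent C' := by
  refine ⟨h, fun z => ?_, fun i z => ?_⟩
  · rw [ho']
    rcases le_or_gt C.outer ‖z‖ with hz | hz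
    · rw [hR z (ho.trans hz)]
    · rw [hz.cmp_eq_lt, cmp_eq_lt_iff]
      by_contra hc
      have := h.injective (hR _ (ho.trans (not_lt.1 hc)))
      rw [this] at hc
      exact hc hz
  · rw [hr']
    rcases le_or_gt ‖z - C.center i‖ (C.radius i) with hz | hz
    · rw [hε i z (hz.trans (hr i))]
      congr 2
      ring
    · rw [hz.cmp_eq_gt, cmp_eq_gt_iff]
      by_contra hc
      set w := h z - C'.center i + C.center i with hw
      have hw1 : w - C.center i = h z - C'.center i := by rw [hw]; ring
      have h1 : ‖w - C.center i‖ ≤ C.radius i := by rw [hw1]; exact not_lt.1 hc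
      have h2 : h w = h z := by
        rw [hε i w (h1.trans (hr i)), hw]
        ring
      rw [h.injective h2] at h1
      linarith

lemma center_injective (C : CircleDomain ι) : Function.Injective C.center := by
  intro i j hij
  by_contra h
  have := C.separated i j h
  rw [hij, sub_self, norm_zero] at this
  linarith [C.radius_pos i, C.radius_pos j]

/-- Any two disks with the same number of round holes are equivalent. -/
theorem equivalent [Fintype ι] (C C' : CircleDomain ι) : C.Equivalent C' := by
  obtain ⟨h, R, ε, hε, hR, hh⟩ := pushesTo_of_injective C.center_injective C'.center_injective
  obtain ⟨ε', hε', h1, h2, h3⟩ : ∃ ε' > 0, ε' ≤ ε ∧ (∀ i, ε' ≤ C.radius i) ∧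
      ∀ i, ε' ≤ C'.radius i := by
    have h1 : ∀ᶠ s in 𝓝[>] (0 : ℝ), s ≤ ε := nhdsWithin_le_nhds (eventually_le_nhds hε)
    have h2 : ∀ᶠ s in 𝓝[>] (0 : ℝ), ∀ i, s ≤ C.radius i :=
      eventually_all.2 fun i => nhdsWithin_le_nhds (eventually_le_nhds (C.radius_pos i))
    have h3 : ∀ᶠ s in 𝓝[>] (0 : ℝ), ∀ i, s ≤ C'.radius i :=
      eventually_all.2 fun i => nhdsWithin_le_nhds (eventually_le_nhds (C'.radius_pos i))
    obtain ⟨s, ⟨h1, h2, h3⟩, h4⟩ := ((h1.and (h2.and h3)).and self_mem_nhdsWithin).exists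
    exact ⟨s, h4, h1, h2, h3⟩
  -- Both domains are normalised to holes of radius `ε'`, on which `h` is a translation, and to an
  -- outer radius `M` beyond the support of `h`.
  set M := max R (max C.outer C'.outer) with hM
  have hM1 : C.outer ≤ M := (le_max_left _ _).trans (le_max_right _ _)
  have hM2 : C'.outer ≤ M := (le_max_right _ _).trans (le_max_right _ _)
  have e1 := (C.equivalent_shrink (fun _ => ε') (fun _ => hε') h2).trans
    ((C.shrink _ (fun _ => hε') h2).equivalent_enlarge M hM1)
  have e2 := (C'.equivalent_shrink (fun _ => ε') (fun _ => hε') h3).trans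
    ((C'.shrink _ (fun _ => hε') h3).equivalent_enlarge M hM2)
  have e3 : ((C.shrink _ (fun _ => hε') h2).enlarge M hM1).Equivalent
      ((C'.shrink _ (fun _ => hε') h3).enlarge M hM2) :=
    equivalent_of_pushesTo hR hh (le_max_left _ _) rfl (fun _ => h1) fun _ => rfl
  exact (e1.trans e3).trans e2.symm

end CircleDomain

/-! ### Doubles -/

/-- The double of the domain `0 ≤ A`. -/
def doubleSet {X : Type*} (A : X → ℝ) : Set (X × ℝ) := {p | p.2 ^ 2 = A p.1}

/-- The map induced on doubles of domains by a map `h` between the domains. -/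
noncomputable def doubleMap {X Y : Type*} (A : X → ℝ) (B : Y → ℝ) (h : X → Y) (p : X × ℝ) : Y × ℝ :=
  (h p.1, p.2 * (√(B (h p.1)) / √(A p.1)))

section doubleMap

variable {X Y : Type*} {A : X → ℝ} {B : Y → ℝ}

lemma abs_snd_eq_of_mem_doubleSet {p : X × ℝ} (hp : p ∈ doubleSet A) : |p.2| = √(A p.1) := by
  rw [← (show p.2 ^ 2 = A p.1 from hp), Real.sqrt_sq_eq_abs]

lemma doubleMap_mem {h : X → Y} (h1 : ∀ x, 0 ≤ A x ↔ 0 ≤ B (h x)) (h2 : ∀ x, 0 < A x ↔ 0 < B (h x))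
    {p : X × ℝ} (hp : p ∈ doubleSet A) : doubleMap A B h p ∈ doubleSet B := by
  have hp' : p.2 ^ 2 = A p.1 := hp
  have hA : 0 ≤ A p.1 := hp' ▸ sq_nonneg _
  have hB := (h1 _).1 hA
  change (p.2 * _) ^ 2 = B (h p.1)
  rw [mul_pow, div_pow, Real.sq_sqrt hA, Real.sq_sqrt hB, hp']
  rcases hA.eq_or_lt with h0 | h0
  · have : B (h p.1) = 0 := le_antisymm (not_lt.1 fun hlt => (h0 ▸ (h2 _).2 hlt).ne rfl) hB
    rw [this, zero_div, mul_zero]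
  · field_simp

lemma doubleMap_doubleMap {h : X → Y} {k : Y → X} (hk : ∀ x, k (h x) = x)
    (h2 : ∀ x, 0 < A x ↔ 0 < B (h x)) {p : X × ℝ} (hp : p ∈ doubleSet A) :
    doubleMap B A k (doubleMap A B h p) = p := by
  have hp' : p.2 ^ 2 = A p.1 := hp
  have hA : 0 ≤ A p.1 := hp' ▸ sq_nonneg _
  refine Prod.ext (hk _) ?_
  change p.2 * _ * (√(A (k (h p.1))) / √(B (h p.1))) = p.2
  rw [hk]
  rcases hA.eq_or_lt with h0 | h0
  · have : p.2 = 0 := by rwa [← h0, sq_eq_zero_iff] at hp'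
    rw [this]
    ring
  · have hs := Real.sqrt_pos.2 h0
    have hs' := Real.sqrt_pos.2 ((h2 _).1 h0)
    field_simp

/-- Over the boundary the ratio of square roots need not be continuous. On the double, however, the
last coordinate of the image has absolute value `√(B (h x))`, which tends to zero there. -/
lemma continuousOn_doubleMap [TopologicalSpace X] [TopologicalSpace Y] {h : X → Y}
    (hh : Continuous h) (hA : Continuous A) (hB : Continuous B)
    (h1 : ∀ x, 0 ≤ A x ↔ 0 ≤ B (h x)) (h2 : ∀ x, 0 < A x ↔ 0 < B (h x)) :
    ContinuousOn (doubleMap A B h) (doubleSet A) := by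
  refine ContinuousOn.prodMk (by fun_prop) ?_
  intro p hp
  have hp' : p.2 ^ 2 = A p.1 := hp
  rcases eq_or_ne p.2 0 with h0 | h0
  · have hA0 : A p.1 = 0 := by rw [← hp', h0, zero_pow two_ne_zero]
    have hB0 : B (h p.1) = 0 := le_antisymm (not_lt.1 fun hlt => (hA0 ▸ (h2 _).2 hlt).ne rfl)
      ((h1 _).1 hA0.ge)
    rw [ContinuousWithinAt, h0, zero_mul, tendsto_zero_iff_norm_tendsto_zero]
    have hc : Tendsto (fun q : X × ℝ => √(B (h q.1))) (𝓝[doubleSet A] p) (𝓝 0) := by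
      have : Continuous fun q : X × ℝ => √(B (h q.1)) := by fun_prop
      simpa [hB0] using (this.tendsto p).mono_left nhdsWithin_le_nhds
    refine hc.congr' ?_
    filter_upwards [self_mem_nhdsWithin] with q hq
    have hm := abs_snd_eq_of_mem_doubleSet (doubleMap_mem h1 h2 hq)
    exact hm.symm
  · have hA0 : √(A p.1) ≠ 0 := by
      rw [← abs_snd_eq_of_mem_doubleSet hp]
      exact abs_ne_zero.2 h0
    refine ContinuousAt.continuousWithinAt ?_
    fun_prop (disch := assumption)

/-- A homeomorphism which maps the domain `0 ≤ A` onto the domain `0 ≤ B` and boundary to boundary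
induces a homeomorphism of the doubles. -/
noncomputable def doubleHomeomorph [TopologicalSpace X] [TopologicalSpace Y] (h : X ≃ₜ Y)
    (hA : Continuous A) (hB : Continuous B)
    (h1 : ∀ x, 0 ≤ A x ↔ 0 ≤ B (h x)) (h2 : ∀ x, 0 < A x ↔ 0 < B (h x)) :
    doubleSet A ≃ₜ doubleSet B :=
  have h1' : ∀ y, 0 ≤ B y ↔ 0 ≤ A (h.symm y) := fun y => by rw [h1, h.apply_symm_apply]
  have h2' : ∀ y, 0 < B y ↔ 0 < A (h.symm y) := fun y => by rw [h2, h.apply_symm_apply]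
  { toFun := fun p => ⟨doubleMap A B h p, doubleMap_mem h1 h2 p.2⟩
    invFun := fun p => ⟨doubleMap B A h.symm p, doubleMap_mem h1' h2' p.2⟩
    left_inv := fun p => Subtype.ext (doubleMap_doubleMap h.symm_apply_apply h2 p.2)
    right_inv := fun p => Subtype.ext (doubleMap_doubleMap h.apply_symm_apply h2' p.2)
    continuous_toFun := Continuous.subtype_mk (continuousOn_iff_continuous_domRestrict.1
      (continuousOn_doubleMap h.continuous hA hB h1 h2)) _
    continuous_invFun := Continuous.subtype_mk (continuousOn_iff_continuous_domRestrict.1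
      (continuousOn_doubleMap h.symm.continuous hB hA h1' h2')) _ }

end doubleMap

/-- If at most one factor of a product fails to be positive, then the product is positive (resp.
nonnegative) if and only if each factor is. -/
lemma prod_pos_and_nonneg_iff {ι : Type*} [Fintype ι] {f : ι → ℝ}
    (hf : ∀ i j, i ≠ j → f i ≤ 0 → 0 < f j) :
    (0 < ∏ i, f i ↔ ∀ i, 0 < f i) ∧ (0 ≤ ∏ i, f i ↔ ∀ i, 0 ≤ f i) := by
  classical
  by_cases h : ∃ i, f i ≤ 0
  · obtain ⟨i, hi⟩ := h
    have hpos : 0 < ∏ j ∈ Finset.univ.erase i, f j :=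
      Finset.prod_pos fun j hj => hf i j (Finset.ne_of_mem_erase hj).symm hi
    rw [← Finset.mul_prod_erase _ f (Finset.mem_univ i), mul_pos_iff_of_pos_right hpos,
      mul_nonneg_iff_of_pos_right hpos]
    refine ⟨⟨fun h => absurd h hi.not_gt, fun h => h i⟩, ⟨fun h j => ?_, fun h => h i⟩⟩
    rcases eq_or_ne i j with rfl | hij
    · exact h
    · exact (hf i j hij hi).le
  · push Not at h
    exact ⟨⟨fun _ => h, fun _ => Finset.prod_pos fun i _ => h i⟩,
      ⟨fun _ i => (h i).le, fun _ => (Finset.prod_pos fun i _ => h i).le⟩⟩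

/-! ### The standard surface as a double -/

/-- The function `A` is positive inside the circle domain `C`, vanishes on its boundary, and is
negative elsewhere. -/
def CircleDomain.IsDefiningFunction {ι : Type*} (C : CircleDomain ι) (A : ℂ → ℝ) : Prop :=
  ∀ z, (0 < A z ↔ ‖z‖ < C.outer ∧ ∀ i, C.radius i < ‖z - C.center i‖) ∧
    (0 ≤ A z ↔ ‖z‖ ≤ C.outer ∧ ∀ i, C.radius i ≤ ‖z - C.center i‖)

/-- At most one factor can fail to be positive, because the holes are disjoint and lie inside the
outer circle. Indexing by `Option ι` treats the outer circle like the holes. -/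
lemma CircleDomain.isDefiningFunction_prod {ι : Type*} [Fintype ι] (C : CircleDomain ι) :
    C.IsDefiningFunction fun z =>
      (C.outer ^ 2 - ‖z‖ ^ 2) * ∏ i, (‖z - C.center i‖ ^ 2 - C.radius i ^ 2) := by
  intro z
  set f : Option ι → ℝ := fun o =>
    o.elim (C.outer ^ 2 - ‖z‖ ^ 2) fun i => ‖z - C.center i‖ ^ 2 - C.radius i ^ 2 with hf
  have hp : (C.outer ^ 2 - ‖z‖ ^ 2) * ∏ i, (‖z - C.center i‖ ^ 2 - C.radius i ^ 2) =
      ∏ o, f o := by rw [Fintype.prod_option]; rfl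
  have hr : ∀ i, 0 ≤ C.radius i := fun i => (C.radius_pos i).le
  have hsub : ∀ i, C.outer ≤ ‖z‖ → C.radius i < ‖z - C.center i‖ := fun i h => by
    linarith [C.inside i, norm_le_norm_add_norm_sub' z (C.center i)]
  have hsep : ∀ i j, i ≠ j → ‖z - C.center i‖ ≤ C.radius i →
      C.radius j < ‖z - C.center j‖ := fun i j hij h => by
    have := norm_sub_le_norm_sub_add_norm_sub (C.center i) z (C.center j)
    rw [norm_sub_rev (C.center i) z] at this
    linarith [C.separated i j hij]
  dsimp only
  rw [hp]
  have key := prod_pos_and_nonneg_iff (f := f) ?_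
  · rw [key.1, key.2]
    simp only [Option.forall, hf, Option.elim, sub_pos, sub_nonneg,
      sq_lt_sq₀ (norm_nonneg _) C.outer_pos.le, sq_le_sq₀ (norm_nonneg _) C.outer_pos.le,
      fun i => sq_lt_sq₀ (hr i) (norm_nonneg (z - C.center i)),
      fun i => sq_le_sq₀ (hr i) (norm_nonneg (z - C.center i)), and_self]
  · rintro (_ | i) (_ | j) hij h
    · exact absurd rfl hij
    · simp only [hf, Option.elim, sub_pos, sub_nonpos] at h ⊢
      rw [sq_le_sq₀ C.outer_pos.le (norm_nonneg _)] at h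
      rw [sq_lt_sq₀ (hr j) (norm_nonneg _)]
      exact hsub j h
    · simp only [hf, Option.elim, sub_pos, sub_nonpos] at h ⊢
      rw [sq_le_sq₀ (norm_nonneg _) (hr i)] at h
      rw [sq_lt_sq₀ (norm_nonneg _) C.outer_pos.le]
      by_contra hc
      exact h.not_gt (hsub i (not_lt.1 hc))
    · simp only [hf, Option.elim, sub_pos, sub_nonpos] at h ⊢
      rw [sq_le_sq₀ (norm_nonneg _) (hr i)] at h
      rw [sq_lt_sq₀ (hr j) (norm_nonneg _)]
      exact hsep i j (fun e => hij (by rw [e])) h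

/-- The doubles of circle domains with the same number of holes are homeomorphic. -/
theorem CircleDomain.nonempty_homeomorph_double {ι : Type*} [Fintype ι] {C C' : CircleDomain ι}
    {A B : ℂ → ℝ} (hA : C.IsDefiningFunction A) (hB : C'.IsDefiningFunction B)
    (hAc : Continuous A) (hBc : Continuous B) : Nonempty (doubleSet A ≃ₜ doubleSet B) := by
  obtain ⟨h, h1, h2⟩ := C.equivalent C'
  have h1' : ∀ z, cmp C'.outer ‖h z‖ = cmp C.outer ‖z‖ := fun z => cmp_eq_cmp_symm.1 (h1 z)
  have h2' : ∀ i z, cmp (C'.radius i) ‖h z - C'.center i‖ = cmp (C.radius i) ‖z - C.center i‖ :=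
    fun i z => cmp_eq_cmp_symm.1 (h2 i z)
  refine ⟨doubleHomeomorph h hAc hBc (fun z => ?_) fun z => ?_⟩
  · rw [(hA z).2, (hB _).2, le_iff_le_of_cmp_eq_cmp (h1 z)]
    simp only [fun i => le_iff_le_of_cmp_eq_cmp (h2' i z)]
  · rw [(hA z).1, (hB _).1, lt_iff_lt_of_cmp_eq_cmp (h1 z)]
    simp only [fun i => lt_iff_lt_of_cmp_eq_cmp (h2' i z)]

/-- The disk of radius `4 g + 1` with `g` holes of radius `1`. -/
def standardDomain (g : ℕ) : CircleDomain (Fin g) where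
  outer := 4 * g + 1
  center k := ((4 * (k : ℕ) : ℝ) : ℂ)
  radius _ := 1
  radius_pos _ := one_pos
  separated i j h := by
    rw [← Complex.ofReal_sub, Complex.norm_real, Real.norm_eq_abs, ← mul_sub, abs_mul]
    have h1 : ((i : ℕ) : ℤ) - (j : ℕ) ≠ 0 := by
      intro h'
      exact h (Fin.ext (by omega))
    have h2 : (1 : ℝ) ≤ |((i : ℕ) : ℝ) - (j : ℕ)| := by exact_mod_cast Int.one_le_abs h1
    rw [abs_of_pos (by norm_num : (0 : ℝ) < 4)]
    linarith
  inside i := by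
    have h1 : ((i : ℕ) : ℝ) + 1 ≤ g := by exact_mod_cast i.2
    rw [Complex.norm_real, Real.norm_eq_abs, abs_of_nonneg (by positivity)]
    linarith
  outer_pos := by positivity

/-- The function which defines the standard surface. -/
noncomputable def standardFunction (g : ℕ) (z : ℂ) : ℝ :=
  ((4 * (g : ℝ) + 1) ^ 2 - z.re ^ 2 - z.im ^ 2) *
    ∏ k ∈ Finset.range g, ((z.re - 4 * (k : ℝ)) ^ 2 + z.im ^ 2 - 1)

lemma continuous_standardFunction (g : ℕ) : Continuous (standardFunction g) := by
  unfold standardFunction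
  have := Complex.continuous_re
  have := Complex.continuous_im
  fun_prop

lemma isDefiningFunction_standardFunction (g : ℕ) :
    (standardDomain g).IsDefiningFunction (standardFunction g) := by
  intro z
  have hf : standardFunction g z = ((standardDomain g).outer ^ 2 - ‖z‖ ^ 2) *
      ∏ i : Fin g, (‖z - (standardDomain g).center i‖ ^ 2 - (standardDomain g).radius i ^ 2) := by
    rw [standardFunction, Finset.prod_range fun k => ((z.re - 4 * (k : ℝ)) ^ 2 + z.im ^ 2 - 1)]
    simp only [Complex.sq_norm, Complex.normSq_apply, standardDomain]
    congr 1
    · ring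
    · refine Finset.prod_congr rfl fun i _ => ?_
      simp only [Complex.sub_re, Complex.sub_im, Complex.ofReal_re, Complex.ofReal_im]
      ring
  exact hf ▸ (standardDomain g).isDefiningFunction_prod z

/-- The standard surface is the double of the standard domain. -/
noncomputable def standardSurfaceHomeomorph (g : ℕ) :
    doubleSet (standardFunction g) ≃ₜ standardSurface g where
  toFun p := ⟨(p.1.1.re, p.1.1.im, p.1.2), p.2⟩
  invFun q := ⟨(⟨q.1.1, q.1.2.1⟩, q.1.2.2), q.2⟩
  left_inv _ := rfl
  right_inv _ := rfl
  continuous_toFun := by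
    have := Complex.continuous_re
    have := Complex.continuous_im
    fun_prop
  continuous_invFun := by
    refine Continuous.subtype_mk (Continuous.prodMk ?_ (by fun_prop)) _
    have : Continuous fun q : ℝ × ℝ => (⟨q.1, q.2⟩ : ℂ) :=
      Complex.equivRealProdCLM.symm.continuous
    exact this.comp (f := fun q : standardSurface g => (q.1.1, q.1.2.1)) (by fun_prop)

/-! ### Linear algebra in `ℝ⁴` -/

lemma inner_pole (x : E4) : ⟪x, pole⟫ = x 3 := by
  simp [pole, EuclideanSpace.inner_single_right]

lemma inner_pole_left (x : E4) : ⟪pole, x⟫ = x 3 := by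
  rw [real_inner_comm, inner_pole]

lemma norm_pole : ‖pole‖ = 1 := by simp [pole]

lemma pole_apply_three : pole 3 = 1 := by simp [pole]

lemma horizontal_apply_three (x : E4) : horizontal x 3 = 0 := by
  simp [horizontal, pole_apply_three]

lemma horizontal_of_apply_three {x : E4} (h : x 3 = 0) : horizontal x = x := by
  simp [horizontal, h]

lemma inner_horizontal (x : E4) {c : E4} (hc : c 3 = 0) : ⟪horizontal x, c⟫ = ⟪x, c⟫ := by
  rw [horizontal, inner_sub_left, inner_smul_left, inner_pole_left, hc]
  simp

lemma norm_horizontal_sq (x : E4) : ‖horizontal x‖ ^ 2 = ‖x‖ ^ 2 - x 3 ^ 2 := by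
  rw [horizontal, norm_sub_sq_real, inner_smul_right, inner_pole, norm_smul, norm_pole,
    Real.norm_eq_abs, mul_one, sq_abs]
  ring

lemma horizontal_add_smul_pole (x : E4) : horizontal x + x 3 • pole = x := sub_add_cancel _ _

lemma horizontal_add (x y : E4) : horizontal (x + y) = horizontal x + horizontal y := by
  simp only [horizontal, PiLp.add_apply, add_smul]
  abel

lemma horizontal_smul (t : ℝ) (x : E4) : horizontal (t • x) = t • horizontal x := by
  simp only [horizontal, PiLp.smul_apply, smul_eq_mul, smul_sub, smul_smul]

lemma horizontal_pole : horizontal pole = 0 := by simp [horizontal, pole_apply_three]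

lemma contDiff_inner_const (c : E4) : ContDiff ℝ ∞ fun x : E4 => ⟪x, c⟫ :=
  contDiff_id.inner ℝ contDiff_const

lemma contDiff_horizontal : ContDiff ℝ ∞ horizontal := by
  have : horizontal = fun x => x - ⟪x, pole⟫ • pole := by
    funext x
    rw [inner_pole, horizontal]
  rw [this]
  have := contDiff_inner_const pole
  fun_prop

lemma contDiff_apply_three : ContDiff ℝ ∞ fun x : E4 => x 3 := by
  have : (fun x : E4 => x 3) = fun x => ⟪x, pole⟫ := funext fun x => (inner_pole x).symm
  rw [this]
  exact contDiff_inner_const pole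

lemma continuous_horizontal : Continuous horizontal := contDiff_horizontal.continuous

lemma continuous_apply_three : Continuous fun x : E4 => x 3 := contDiff_apply_three.continuous

lemma mem_sphereThree {x : E4} : x ∈ sphereThree ↔ ‖x‖ = 1 := mem_sphere_zero_iff_norm

lemma norm_eq_one_of_mem_sphereTwo {x : E4} (hx : x ∈ sphereTwo) : ‖x‖ = 1 :=
  mem_sphereThree.1 hx.1

lemma sphereProj_apply_three (x : E4) : sphereProj x 3 = 0 := by
  simp [sphereProj, horizontal_apply_three]

lemma sphereProj_mem_sphereTwo {x : E4} (hx : horizontal x ≠ 0) : sphereProj x ∈ sphereTwo :=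
  ⟨mem_sphereThree.2 (norm_smul_inv_norm hx), sphereProj_apply_three x⟩

lemma sphereProj_of_mem_sphereTwo {x : E4} (hx : x ∈ sphereTwo) : sphereProj x = x := by
  rw [sphereProj, horizontal_of_apply_three hx.2, norm_eq_one_of_mem_sphereTwo hx, inv_one,
    one_smul]

lemma norm_horizontal_smul_sphereProj {x : E4} (hx : horizontal x ≠ 0) :
    ‖horizontal x‖ • sphereProj x = horizontal x := by
  rw [sphereProj, smul_inv_smul₀ (norm_ne_zero_iff.2 hx)]

lemma inner_sphereProj (x : E4) {c : E4} (hc : c 3 = 0) :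
    ⟪sphereProj x, c⟫ = ⟪x, c⟫ / ‖horizontal x‖ := by
  rw [sphereProj, inner_smul_left, inner_horizontal x hc]
  simp [div_eq_inv_mul]

lemma isCompact_sphereTwo : IsCompact sphereTwo := by
  have h1 : IsCompact sphereThree := isCompact_sphere 0 1
  have h2 : IsClosed {x : E4 | x 3 = 0} := isClosed_singleton.preimage continuous_apply_three
  exact h1.inter_right h2

/-! ### Spherical disks -/

lemma mem_sphericalDisk_iff {c : E4} (hc : c ∈ sphereTwo) {r : ℝ} (h0 : 0 < r) (h1 : r < Real.pi)
    {x : E4} : x ∈ sphericalDisk c r ↔ x ∈ sphereTwo ∧ Real.cos r < ⟪x, c⟫ := by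
  refine and_congr_right fun hx => ?_
  have hx1 := norm_eq_one_of_mem_sphereTwo hx
  have hc1 := norm_eq_one_of_mem_sphereTwo hc
  have hcos : Real.cos (InnerProductGeometry.angle x c) = ⟪x, c⟫ := by
    rw [InnerProductGeometry.cos_angle, hx1, hc1]
    simp
  rw [← hcos]
  exact (Real.strictAntiOn_cos.lt_iff_gt ⟨h0.le, h1.le⟩
    ⟨InnerProductGeometry.angle_nonneg _ _, InnerProductGeometry.angle_le_pi _ _⟩).symm

/-- A point of the boundary circle is the limit of the normalised vectors `x + t • c` as `t`
decreases to `0`, and these lie in the open disk. -/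
lemma mem_closure_sphericalDisk {c : E4} (hc : c ∈ sphereTwo) {r : ℝ} (h0 : 0 < r)
    (h1 : r < Real.pi / 2) {x : E4} (hx : x ∈ sphereTwo) (h : Real.cos r ≤ ⟪x, c⟫) :
    x ∈ closure (sphericalDisk c r) := by
  have hpi : r < Real.pi := by linarith [Real.pi_pos]
  rcases h.lt_or_eq with h | h
  · exact subset_closure ((mem_sphericalDisk_iff hc h0 hpi).2 ⟨hx, h⟩)
  have ha0 : 0 < Real.cos r := Real.cos_pos_of_mem_Ioo ⟨by linarith, h1⟩
  have ha1 : Real.cos r < 1 := by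
    have := Real.sin_pos_of_pos_of_lt_pi h0 hpi
    nlinarith [Real.sin_sq_add_cos_sq r]
  set a := Real.cos r with ha
  have hx1 := norm_eq_one_of_mem_sphereTwo hx
  have hc1 := norm_eq_one_of_mem_sphereTwo hc
  have hns : ∀ t : ℝ, ‖x + t • c‖ ^ 2 = 1 + 2 * t * a + t ^ 2 := fun t => by
    rw [norm_add_sq_real, inner_smul_right, norm_smul, hx1, hc1, ← h, mul_one, Real.norm_eq_abs,
      sq_abs]
    ring
  have hlim : Tendsto (fun t : ℝ => ‖x + t • c‖⁻¹ • (x + t • c)) (𝓝[>] 0) (𝓝 x) := by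
    have hc : ContinuousAt (fun t : ℝ => ‖x + t • c‖⁻¹ • (x + t • c)) 0 := by
      have : ‖x + (0 : ℝ) • c‖ ≠ 0 := by simp [hx1]
      fun_prop (disch := assumption)
    have := hc.tendsto
    simp only [zero_smul, add_zero, hx1, inv_one, one_smul] at this
    exact this.mono_left nhdsWithin_le_nhds
  refine mem_closure_of_tendsto hlim ?_
  filter_upwards [self_mem_nhdsWithin] with t ht
  have ht : 0 < t := ht
  have hpos : 0 < ‖x + t • c‖ := by
    refine lt_of_le_of_ne (norm_nonneg _) fun h0 => ?_
    have := hns t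
    rw [← h0] at this
    nlinarith [mul_pos ht ha0]
  refine (mem_sphericalDisk_iff hc h0 hpi).2 ⟨⟨mem_sphereThree.2 ?_, ?_⟩, ?_⟩
  · exact norm_smul_inv_norm (norm_pos_iff.1 hpos)
  · simp [hx.2, hc.2]
  · rw [inner_smul_left, inner_add_left, inner_smul_left, real_inner_self_eq_norm_sq, hc1, ← h]
    simp only [conj_trivial, one_pow, mul_one]
    rw [inv_mul_eq_div, lt_div_iff₀ hpos]
    refine lt_of_pow_lt_pow_left₀ 2 (by positivity) ?_
    rw [mul_pow, hns]
    -- This is the difference `(a + t) ^ 2 - a ^ 2 * ‖x + t • c‖ ^ 2`.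
    have : 0 < (1 - a ^ 2) * (2 * a * t + t ^ 2) :=
      mul_pos (by nlinarith) (by positivity)
    nlinarith

namespace SphericalBilliard

variable {n : ℕ} (B : SphericalBilliard n)

/-- The disk `Δᵢ` is cut out of the sphere by `⟪x, cᵢ⟫ > B.height i`. -/
noncomputable def height (i : Fin n) : ℝ := Real.cos (B.radius i)

lemma height_pos (i : Fin n) : 0 < B.height i :=
  Real.cos_pos_of_mem_Ioo ⟨by linarith [B.radius_pos i, Real.pi_pos], B.radius_lt i⟩

lemma height_lt_one (i : Fin n) : B.height i < 1 := by
  have := Real.sin_pos_of_pos_of_lt_pi (B.radius_pos i)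
    (by linarith [Real.pi_pos, B.radius_lt i])
  have h2 := Real.sin_sq_add_cos_sq (B.radius i)
  have := B.height_pos i
  unfold height at *
  nlinarith

lemma norm_center (i : Fin n) : ‖B.center i‖ = 1 := norm_eq_one_of_mem_sphereTwo (B.center_mem i)

lemma center_apply_three (i : Fin n) : B.center i 3 = 0 := (B.center_mem i).2

lemma mem_obstacle_iff {i : Fin n} {x : E4} :
    x ∈ B.obstacle i ↔ x ∈ sphereTwo ∧ B.height i < ⟪x, B.center i⟫ :=
  mem_sphericalDisk_iff (B.center_mem i) (B.radius_pos i) (by linarith [Real.pi_pos, B.radius_lt i])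

lemma mem_closure_obstacle_iff {i : Fin n} {x : E4} :
    x ∈ closure (B.obstacle i) ↔ x ∈ sphereTwo ∧ B.height i ≤ ⟪x, B.center i⟫ := by
  refine ⟨fun h => ?_, fun h =>
    mem_closure_sphericalDisk (B.center_mem i) (B.radius_pos i) (B.radius_lt i) h.1 h.2⟩
  have hcl : IsClosed {x : E4 | x ∈ sphereTwo ∧ B.height i ≤ ⟪x, B.center i⟫} :=
    isCompact_sphereTwo.isClosed.inter (isClosed_le continuous_const (contDiff_inner_const _).continuous)
  refine closure_minimal (fun y hy => ?_) hcl h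
  have := B.mem_obstacle_iff.1 hy
  exact ⟨this.1, this.2.le⟩

lemma inner_lt_height {i j : Fin n} (hij : i ≠ j) {x : E4} (hx : x ∈ sphereTwo)
    (h : B.height i ≤ ⟪x, B.center i⟫) : ⟪x, B.center j⟫ < B.height j := by
  by_contra hc
  exact Set.disjoint_left.1 (B.disjoint_closures i j hij)
    (B.mem_closure_obstacle_iff.2 ⟨hx, h⟩) (B.mem_closure_obstacle_iff.2 ⟨hx, not_lt.1 hc⟩)

lemma mem_domain_iff {x : E4} :
    x ∈ B.domain ↔ x ∈ sphereTwo ∧ ∀ i, ⟪x, B.center i⟫ ≤ B.height i := by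
  simp only [domain, Set.mem_sdiff, mem_iUnion, mem_obstacle_iff, not_exists]
  refine and_congr_right fun hx => forall_congr' fun i => ?_
  simp [hx]

lemma boundary_obstacle_subset {i : Fin n} {x : E4}
    (hx : x ∈ boundaryInSphereTwo (B.obstacle i)) :
    x ∈ sphereTwo ∧ ⟪x, B.center i⟫ = B.height i := by
  have h1 := B.mem_closure_obstacle_iff.1 hx.1
  have hcl : IsClosed {x : E4 | ⟪x, B.center i⟫ ≤ B.height i} :=
    isClosed_le (by fun_prop) continuous_const
  refine ⟨h1.1, le_antisymm (closure_minimal (fun y hy => ?_) hcl hx.2) h1.2⟩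
  by_contra hc
  exact hy.2 (B.mem_obstacle_iff.2 ⟨hy.1, not_le.1 hc⟩)

lemma mem_boundary_domain_iff {x : E4} :
    x ∈ boundaryInSphereTwo B.domain ↔ x ∈ B.domain ∧ ∃ i, ⟪x, B.center i⟫ = B.height i := by
  have hcl : IsClosed B.domain := by
    have : B.domain = sphereTwo ∩ ⋂ i, {x | ⟪x, B.center i⟫ ≤ B.height i} := by
      ext x
      simp [mem_domain_iff]
    rw [this]
    exact isCompact_sphereTwo.isClosed.inter
      (isClosed_iInter fun i => isClosed_le (by fun_prop) continuous_const)
  have hdiff : sphereTwo \ B.domain = ⋃ i, B.obstacle i := by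
    rw [domain, sdiff_sdiff_right_self, inter_eq_right]
    exact iUnion_subset fun i x hx => hx.1
  rw [boundaryInSphereTwo, hcl.closure_eq, hdiff, closure_iUnion_of_finite, mem_inter_iff,
    mem_iUnion]
  refine and_congr_right fun hx => exists_congr fun i => ?_
  have := B.mem_domain_iff.1 hx
  rw [mem_closure_obstacle_iff]
  exact ⟨fun h => le_antisymm (this.2 i) h.2, fun h => ⟨this.1, h.ge⟩⟩

/-- `δ` is small enough for the enlarged obstacles to be disjoint and smaller than hemispheres. -/
def IsMargin (δ : ℝ) : Prop :=
  0 < δ ∧ (∀ i, δ < B.height i) ∧ ∀ i j, i ≠ j → ∀ x ∈ sphereTwo,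
    B.height i - δ ≤ ⟪x, B.center i⟫ → ⟪x, B.center j⟫ < B.height j - δ

/-- For two obstacles, the closures being disjoint, the larger of the gaps `B.height i - ⟪x,
B.center i⟫` and `B.height j - ⟪x, B.center j⟫` is positive everywhere on the sphere. By compactness
it is bounded below by some `m > 0`, and any positive `δ < m` suits this pair. -/
lemma exists_isMargin : ∃ δ, B.IsMargin δ := by
  have h1 : ∀ᶠ δ in 𝓝[>] (0 : ℝ), ∀ i, δ < B.height i :=
    eventually_all.2 fun i => nhdsWithin_le_nhds (eventually_lt_nhds (B.height_pos i))
  have h2 : ∀ᶠ δ in 𝓝[>] (0 : ℝ), ∀ i j, i ≠ j → ∀ x ∈ sphereTwo,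
      B.height i - δ ≤ ⟪x, B.center i⟫ → ⟪x, B.center j⟫ < B.height j - δ := by
    refine eventually_all.2 fun i => eventually_all.2 fun j => ?_
    by_cases hij : i = j
    · simp [hij]
    obtain ⟨m, hm, h⟩ := isCompact_sphereTwo.exists_forall_le' (a := 0)
      (f := fun x => max (B.height i - ⟪x, B.center i⟫) (B.height j - ⟪x, B.center j⟫))
      (by fun_prop) fun x hx => by
        rcases lt_or_ge ⟪x, B.center i⟫ (B.height i) with h | h
        · exact lt_max_of_lt_left (sub_pos.2 h)
        · exact lt_max_of_lt_right (sub_pos.2 (B.inner_lt_height hij hx h))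
    filter_upwards [nhdsWithin_le_nhds (eventually_lt_nhds hm)] with δ hδ _ x hx hxi
    rcases le_max_iff.1 (h x hx) with h | h <;> linarith
  obtain ⟨δ, ⟨h1, h2⟩, h3⟩ := ((h1.and h2).and self_mem_nhdsWithin).exists
  exact ⟨δ, h3, h1, h2⟩

end SphericalBilliard

/-! ### A function defining the billiard table -/

/-- A smooth function of `t` with the sign of `a - t`, equal to `1` for `t ≤ a - δ` and to
`a ^ 2 - t ^ 2` for `t ≥ a - δ / 2`. -/
noncomputable def profile (a δ t : ℝ) : ℝ :=
  1 + Real.smoothTransition ((t - (a - δ)) / (δ / 2)) * (a ^ 2 - t ^ 2 - 1)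

lemma contDiff_profile (a δ : ℝ) : ContDiff ℝ ∞ (profile a δ) := by
  have : ContDiff ℝ ∞ fun t : ℝ => Real.smoothTransition ((t - (a - δ)) / (δ / 2)) :=
    Real.smoothTransition.contDiff.comp (by fun_prop)
  unfold profile
  fun_prop

lemma profile_eq_one {a δ t : ℝ} (hδ : 0 < δ) (h : t ≤ a - δ) : profile a δ t = 1 := by
  have : (t - (a - δ)) / (δ / 2) ≤ 0 := div_nonpos_of_nonpos_of_nonneg (by linarith) (by linarith)
  rw [profile, Real.smoothTransition.zero_of_nonpos this, zero_mul, add_zero]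

lemma profile_eq {a δ t : ℝ} (hδ : 0 < δ) (h : a - δ / 2 ≤ t) : profile a δ t = a ^ 2 - t ^ 2 := by
  have : 1 ≤ (t - (a - δ)) / (δ / 2) := (one_le_div (by positivity)).2 (by linarith)
  rw [profile, Real.smoothTransition.one_of_one_le this]
  ring

/-- The profile is a convex combination of `1` and `a ^ 2 - t ^ 2`; the latter is positive where it
matters, since there `0 < a - δ < t < a`. -/
lemma profile_pos {a δ t : ℝ} (hδ : 0 < δ) (ha : δ < a) (h : t < a) : 0 < profile a δ t := by
  rcases le_or_gt t (a - δ) with h1 | h1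
  · rw [profile_eq_one hδ h1]
    exact one_pos
  · have h2 := Real.smoothTransition.nonneg ((t - (a - δ)) / (δ / 2))
    have h3 := Real.smoothTransition.le_one ((t - (a - δ)) / (δ / 2))
    rw [profile]
    set χ := Real.smoothTransition ((t - (a - δ)) / (δ / 2))
    have h4 : 0 < a ^ 2 - t ^ 2 := by nlinarith
    rcases h2.eq_or_lt with h5 | h5
    · rw [← h5]
      norm_num
    · nlinarith [mul_pos h5 h4]

lemma profile_pos_iff {a δ t : ℝ} (hδ : 0 < δ) (ha : δ < a) : 0 < profile a δ t ↔ t < a := by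
  refine ⟨fun h => ?_, profile_pos hδ ha⟩
  by_contra hc
  rw [profile_eq hδ (by linarith)] at h
  nlinarith

lemma profile_nonneg_iff {a δ t : ℝ} (hδ : 0 < δ) (ha : δ < a) : 0 ≤ profile a δ t ↔ t ≤ a := by
  refine ⟨fun h => ?_, fun h => ?_⟩
  · by_contra hc
    rw [profile_eq hδ (by linarith)] at h
    nlinarith
  · rcases h.lt_or_eq with h | h
    · exact (profile_pos hδ ha h).le
    · rw [h, profile_eq hδ (by linarith), sub_self]

namespace SphericalBilliard

variable {n : ℕ} (B : SphericalBilliard n)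

/-- A function on the sphere which is positive in the interior of the billiard table, vanishes on
its boundary, and is negative on the obstacles. -/
noncomputable def tableFunction (δ : ℝ) (x : E4) : ℝ :=
  ∏ i, profile (B.height i) δ ⟪x, B.center i⟫

lemma contDiff_tableFunction (δ : ℝ) : ContDiff ℝ ∞ (B.tableFunction δ) :=
  contDiff_prod fun _ _ => (contDiff_profile _ _).comp (contDiff_inner_const _)

lemma tableFunction_pos_iff_and {δ : ℝ} (hδ : B.IsMargin δ) {x : E4} (hx : x ∈ sphereTwo) :
    (0 < B.tableFunction δ x ↔ ∀ i, ⟪x, B.center i⟫ < B.height i) ∧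
      (0 ≤ B.tableFunction δ x ↔ ∀ i, ⟪x, B.center i⟫ ≤ B.height i) := by
  obtain ⟨h0, h1, -⟩ := hδ
  have := prod_pos_and_nonneg_iff
    (f := fun i => profile (B.height i) δ ⟪x, B.center i⟫) fun i j hij hi => by
      rw [← not_lt, profile_pos_iff h0 (h1 i), not_lt] at hi
      exact profile_pos h0 (h1 j) (B.inner_lt_height hij hx hi)
  refine ⟨this.1.trans (forall_congr' fun i => profile_pos_iff h0 (h1 i)),
    this.2.trans (forall_congr' fun i => profile_nonneg_iff h0 (h1 i))⟩

lemma tableFunction_pos_iff {δ : ℝ} (hδ : B.IsMargin δ) {x : E4} (hx : x ∈ sphereTwo) :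
    0 < B.tableFunction δ x ↔ ∀ i, ⟪x, B.center i⟫ < B.height i :=
  (B.tableFunction_pos_iff_and hδ hx).1

lemma tableFunction_nonneg_iff {δ : ℝ} (hδ : B.IsMargin δ) {x : E4} (hx : x ∈ sphereTwo) :
    0 ≤ B.tableFunction δ x ↔ ∀ i, ⟪x, B.center i⟫ ≤ B.height i :=
  (B.tableFunction_pos_iff_and hδ hx).2

/-- Within the margin of one obstacle, the factors of all the others are equal to `1`. -/
lemma tableFunction_eq {δ : ℝ} (hδ : B.IsMargin δ) {x : E4} (hx : x ∈ sphereTwo) {i : Fin n}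
    (hi : B.height i - δ / 2 ≤ ⟪x, B.center i⟫) :
    B.tableFunction δ x = B.height i ^ 2 - ⟪x, B.center i⟫ ^ 2 := by
  obtain ⟨h0, h1, h2⟩ := hδ
  rw [tableFunction, Finset.prod_eq_single i, profile_eq h0 hi]
  · intro j _ hj
    exact profile_eq_one h0 (h2 i j hj.symm x hx (by linarith)).le
  · simp

end SphericalBilliard

/-! ### Curves on quadrics -/

/-- First and second order consequences of the fact that a quadratic form is constant along a
curve. -/
lemma deriv_quadratic_const {γ : ℝ → E4} (hγ : ContDiffAt ℝ ∞ γ 0) (L : E4 →L[ℝ] E4)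
    (hL : ∀ x y, ⟪L x, y⟫ = ⟪x, L y⟫) {k : ℝ} (h : ∀ᶠ t in 𝓝 (0 : ℝ), ⟪γ t, L (γ t)⟫ = k) :
    ⟪deriv γ 0, L (γ 0)⟫ = 0 ∧
      ⟪deriv γ 0, L (deriv γ 0)⟫ + ⟪deriv (deriv γ) 0, L (γ 0)⟫ = 0 := by
  have hdiff : ∀ᶠ t in 𝓝 (0 : ℝ), DifferentiableAt ℝ γ t := by
    have : ContDiffAt ℝ 1 γ 0 := hγ.of_le (by exact_mod_cast le_top)
    filter_upwards [this.eventually (by simp)] with t ht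
    exact ht.differentiableAt one_ne_zero
  have hdiff2 : DifferentiableAt ℝ (deriv γ) 0 := by
    have h1 : ContDiffAt ℝ ∞ (fderiv ℝ γ) 0 := hγ.fderiv_right le_rfl
    have h2 := h1.differentiableAt (by simp)
    exact h2.clm_apply (differentiableAt_const (1 : ℝ))
  have key : ∀ᶠ t in 𝓝 (0 : ℝ), ⟪deriv γ t, L (γ t)⟫ = 0 := by
    filter_upwards [hdiff, h.eventually_nhds] with t ht hk
    have h1 := ht.hasDerivAt.inner ℝ (L.hasFDerivAt.comp_hasDerivAt t ht.hasDerivAt)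
    have h2 := h1.unique ((hasDerivAt_const t k).congr_of_eventuallyEq hk)
    rw [← hL, real_inner_comm, Function.comp_apply] at h2
    rw [real_inner_comm] at h2
    linarith [real_inner_comm (deriv γ t) (L (γ t))]
  refine ⟨key.self_of_nhds, ?_⟩
  have h0 := hdiff.self_of_nhds
  have h1 := hdiff2.hasDerivAt.inner ℝ (L.hasFDerivAt.comp_hasDerivAt 0 h0.hasDerivAt)
  exact h1.unique ((hasDerivAt_const 0 (0 : ℝ)).congr_of_eventuallyEq key)

/-! ### The fibres of the projection -/

/-- The point above `z` in the fibre of the projection, at slope `t`. -/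
noncomputable def fiberPoint (z : E4) (t : ℝ) : E4 := (√(1 + t ^ 2))⁻¹ • (z + t • pole)

lemma fiberPoint_apply_three {z : E4} (hz : z ∈ sphereTwo) (t : ℝ) :
    fiberPoint z t 3 = (√(1 + t ^ 2))⁻¹ * t := by
  simp [fiberPoint, hz.2, pole_apply_three]

lemma horizontal_fiberPoint {z : E4} (hz : z ∈ sphereTwo) (t : ℝ) :
    horizontal (fiberPoint z t) = (√(1 + t ^ 2))⁻¹ • z := by
  rw [fiberPoint, horizontal_smul, horizontal_add, horizontal_smul, horizontal_pole,
    horizontal_of_apply_three hz.2, smul_zero, add_zero]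

lemma norm_horizontal_fiberPoint {z : E4} (hz : z ∈ sphereTwo) (t : ℝ) :
    ‖horizontal (fiberPoint z t)‖ = (√(1 + t ^ 2))⁻¹ := by
  rw [horizontal_fiberPoint hz, norm_smul, norm_eq_one_of_mem_sphereTwo hz, mul_one,
    Real.norm_eq_abs, abs_of_nonneg (by positivity)]

lemma horizontal_fiberPoint_ne_zero {z : E4} (hz : z ∈ sphereTwo) (t : ℝ) :
    horizontal (fiberPoint z t) ≠ 0 := by
  rw [← norm_ne_zero_iff, norm_horizontal_fiberPoint hz]
  positivity

lemma sphereProj_fiberPoint {z : E4} (hz : z ∈ sphereTwo) (t : ℝ) :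
    sphereProj (fiberPoint z t) = z := by
  rw [sphereProj, norm_horizontal_fiberPoint hz, horizontal_fiberPoint hz,
    inv_smul_smul₀ (by positivity)]

lemma fiberPoint_mem_sphereThree {z : E4} (hz : z ∈ sphereTwo) (t : ℝ) :
    fiberPoint z t ∈ sphereThree := by
  have h := norm_horizontal_sq (fiberPoint z t)
  rw [norm_horizontal_fiberPoint hz, fiberPoint_apply_three hz, mul_pow, inv_pow,
    Real.sq_sqrt (by positivity)] at h
  have h1 : ‖fiberPoint z t‖ ^ 2 = 1 := by
    have h2 : (1 + t ^ 2)⁻¹ * (1 + t ^ 2) = 1 := inv_mul_cancel₀ (by positivity)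
    linarith
  exact mem_sphereThree.2 ((pow_eq_one_iff_of_nonneg (norm_nonneg _) two_ne_zero).1 h1)

lemma fiberPoint_sphereProj {x : E4} (hx : x ∈ sphereThree) (h0 : horizontal x ≠ 0) :
    fiberPoint (sphereProj x) (x 3 / ‖horizontal x‖) = x := by
  have hn := norm_pos_iff.2 h0
  have hh := norm_horizontal_sq x
  rw [mem_sphereThree.1 hx, one_pow] at hh
  have h1 : 1 + (x 3 / ‖horizontal x‖) ^ 2 = (‖horizontal x‖⁻¹) ^ 2 := by
    field_simp
    linarith
  rw [fiberPoint, h1, Real.sqrt_sq (by positivity), inv_inv, smul_add, smul_smul,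
    norm_horizontal_smul_sphereProj h0, mul_div_cancel₀ _ hn.ne', horizontal_add_smul_pole]

/-! ### The surface above the table and its local equations -/

namespace SphericalBilliard

variable {n : ℕ} (B : SphericalBilliard n)

/-- The double of the billiard table, as a surface in `𝕊³`. -/
def doubleSurface (δ : ℝ) : Set E4 :=
  {x | x ∈ sphereThree ∧ horizontal x ≠ 0 ∧
    x 3 ^ 2 = ‖horizontal x‖ ^ 2 * B.tableFunction δ (sphereProj x)}

/-- The function which defines the surface away from the poles. -/
noncomputable def surfaceFunction (δ : ℝ) (x : E4) : ℝ :=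
  x 3 ^ 2 - ‖horizontal x‖ ^ 2 * B.tableFunction δ (sphereProj x)

/-- An open neighbourhood of the boundary of the `i`-th obstacle. -/
def collar (δ : ℝ) (i : Fin n) : Set E4 :=
  {x | (B.height i - δ / 2) * ‖horizontal x‖ < ⟪x, B.center i⟫}

/-- The function which defines the surface near the boundary of the `i`-th obstacle. -/
noncomputable def quadric (i : Fin n) (x : E4) : ℝ :=
  x 3 ^ 2 + ⟪x, B.center i⟫ ^ 2 - B.height i ^ 2 * (1 - x 3 ^ 2)

lemma isOpen_collar (δ : ℝ) (i : Fin n) : IsOpen (B.collar δ i) := by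
  have := continuous_horizontal
  exact isOpen_lt (by fun_prop) (contDiff_inner_const _).continuous

variable {δ : ℝ}

lemma horizontal_ne_zero_of_mem_collar {i : Fin n} {x : E4} (hx : x ∈ B.collar δ i) :
    horizontal x ≠ 0 := by
  intro h
  have h1 : (B.height i - δ / 2) * ‖horizontal x‖ < ⟪x, B.center i⟫ := hx
  rw [← inner_horizontal x (B.center_apply_three i), h] at h1
  simp at h1

lemma mem_collar_of_inner_eq (hδ : B.IsMargin δ) {i : Fin n} {x : E4} (hx : x ∈ sphereTwo)
    (h : ⟪x, B.center i⟫ = B.height i) : x ∈ B.collar δ i := by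
  change (B.height i - δ / 2) * ‖horizontal x‖ < ⟪x, B.center i⟫
  rw [horizontal_of_apply_three hx.2, norm_eq_one_of_mem_sphereTwo hx, h]
  linarith [hδ.1]

/-- Near the boundary of an obstacle, the surface is a quadric. -/
lemma mem_doubleSurface_iff_of_mem_collar (hδ : B.IsMargin δ) {i : Fin n} {x : E4}
    (hx : x ∈ B.collar δ i) : x ∈ B.doubleSurface δ ↔ x ∈ sphereThree ∧ B.quadric i x = 0 := by
  have h0 := B.horizontal_ne_zero_of_mem_collar hx
  have hn := norm_pos_iff.2 h0
  refine and_congr_right fun hx1 => ?_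
  have hh := norm_horizontal_sq x
  rw [mem_sphereThree.1 hx1, one_pow] at hh
  have hin : B.height i - δ / 2 ≤ ⟪sphereProj x, B.center i⟫ := by
    rw [inner_sphereProj _ (B.center_apply_three i), le_div_iff₀ hn]
    exact le_of_lt hx
  -- The factor `‖horizontal x‖ ^ 2 = 1 - x 3 ^ 2` clears the denominator coming from the
  -- normalisation in `sphereProj`, which leaves a quadratic equation.
  rw [B.tableFunction_eq hδ (sphereProj_mem_sphereTwo h0) hin,
    inner_sphereProj _ (B.center_apply_three i), quadric, ← hh, div_pow, mul_sub,
    mul_div_cancel₀ _ (by positivity)]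
  simp only [ne_eq, h0, not_false_eq_true, true_and]
  constructor <;> intro h <;> linarith

lemma fiberPoint_mem_doubleSurface {z : E4} (hz : z ∈ sphereTwo) {t : ℝ}
    (h : t ^ 2 = B.tableFunction δ z) : fiberPoint z t ∈ B.doubleSurface δ := by
  refine ⟨fiberPoint_mem_sphereThree hz t, horizontal_fiberPoint_ne_zero hz t, ?_⟩
  rw [fiberPoint_apply_three hz, norm_horizontal_fiberPoint hz, sphereProj_fiberPoint hz, ← h,
    mul_pow]

lemma surfaceFunction_eq_zero_iff {x : E4} : B.surfaceFunction δ x = 0 ↔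
    x 3 ^ 2 = ‖horizontal x‖ ^ 2 * B.tableFunction δ (sphereProj x) := sub_eq_zero

lemma isOpen_horizontal_ne_zero : IsOpen {x : E4 | horizontal x ≠ 0} :=
  isOpen_ne_fun continuous_horizontal continuous_const

lemma contDiffAt_surfaceFunction {x : E4} (hx : horizontal x ≠ 0) :
    ContDiffAt ℝ ∞ (B.surfaceFunction δ) x := by
  have h1 : ContDiffAt ℝ ∞ horizontal x := contDiff_horizontal.contDiffAt
  have h2 : ContDiffAt ℝ ∞ (fun y => ‖horizontal y‖) x := h1.norm ℝ hx
  have h3 : ContDiffAt ℝ ∞ sphereProj x := (h2.inv (norm_ne_zero_iff.2 hx)).smul h1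
  have h4 : ContDiffAt ℝ ∞ (fun y => B.tableFunction δ (sphereProj y)) x :=
    (B.contDiff_tableFunction δ).contDiffAt.comp x h3
  exact (contDiff_apply_three.contDiffAt.pow 2).sub ((h2.pow 2).mul h4)

lemma horizontal_add_smul_radialVector {x : E4} (hx : horizontal x ≠ 0) (t : ℝ) :
    horizontal (x + t • radialVector x) = (‖horizontal x‖ - t * x 3) • sphereProj x := by
  have h1 : horizontal (radialVector x) = - x 3 • sphereProj x := by
    rw [radialVector, sub_eq_add_neg, ← neg_smul, horizontal_add, horizontal_smul, horizontal_smul,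
      horizontal_pole, horizontal_of_apply_three (sphereProj_apply_three x)]
    simp
  rw [horizontal_add, horizontal_smul, h1, sub_smul, norm_horizontal_smul_sphereProj hx, smul_smul]
  simp [sub_eq_add_neg]

lemma radialVector_apply_three (x : E4) : radialVector x 3 = ‖horizontal x‖ := by
  simp [radialVector, pole_apply_three, sphereProj_apply_three]

lemma inner_radialVector {x : E4} (hx : horizontal x ≠ 0) : ⟪x, radialVector x⟫ = 0 := by
  have h1 : ⟪x, horizontal x⟫ = ‖horizontal x‖ ^ 2 := by
    rw [norm_horizontal_sq, horizontal, inner_sub_right, inner_smul_right, inner_pole,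
      real_inner_self_eq_norm_sq, sq (x 3)]
  have hn := norm_ne_zero_iff.2 hx
  rw [radialVector, inner_sub_right, inner_smul_right, inner_smul_right, inner_pole, sphereProj,
    inner_smul_right, h1]
  field_simp
  ring

lemma radialVector_of_mem_sphereTwo {x : E4} (hx : x ∈ sphereTwo) : radialVector x = pole := by
  rw [radialVector, horizontal_of_apply_three hx.2, hx.2, norm_eq_one_of_mem_sphereTwo hx]
  simp

/-- Near `t = 0` the straight line `x + t • radialVector x` stays over the same point of the great
sphere, so the table function is constant along it and only two squares of affine functions of `t`
are differentiated. -/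
lemma fderiv_surfaceFunction_radialVector {x : E4} (hx : horizontal x ≠ 0) :
    fderiv ℝ (B.surfaceFunction δ) x (radialVector x) =
      2 * x 3 * ‖horizontal x‖ * (1 + B.tableFunction δ (sphereProj x)) := by
  have hd : DifferentiableAt ℝ (B.surfaceFunction δ) x :=
    (B.contDiffAt_surfaceFunction hx).differentiableAt (by simp)
  rw [← hd.lineDeriv_eq_fderiv]
  refine HasLineDerivAt.lineDeriv ?_
  have hn := norm_pos_iff.2 hx
  set b := ‖horizontal x‖ with hb
  set P := B.tableFunction δ (sphereProj x) with hP
  have h1 : HasDerivAt (fun t : ℝ => (x 3 + t * b) ^ 2 - (b - t * x 3) ^ 2 * P)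
      (2 * x 3 * b * (1 + P)) 0 := by
    have e1 : HasDerivAt (fun t : ℝ => x 3 + t * b) (1 * b) 0 :=
      ((hasDerivAt_id (0 : ℝ)).mul_const b).const_add _
    have e2 : HasDerivAt (fun t : ℝ => b - t * x 3) (-(1 * x 3)) 0 :=
      ((hasDerivAt_id (0 : ℝ)).mul_const (x 3)).const_sub _
    refine ((e1.pow 2).sub ((e2.pow 2).mul_const P)).congr_deriv ?_
    simp
    ring
  refine h1.congr_of_eventuallyEq ?_
  have h2 : ∀ᶠ t : ℝ in 𝓝 0, 0 < b - t * x 3 := by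
    have : ContinuousAt (fun t : ℝ => b - t * x 3) 0 := by fun_prop
    exact this.eventually_const_lt (by simpa using hn)
  filter_upwards [h2] with t ht
  have h3 := horizontal_add_smul_radialVector hx t
  have hπ : ‖sphereProj x‖ = 1 := norm_eq_one_of_mem_sphereTwo (sphereProj_mem_sphereTwo hx)
  have h4 : ‖horizontal (x + t • radialVector x)‖ = b - t * x 3 := by
    rw [h3, norm_smul, hπ, mul_one, Real.norm_eq_abs, abs_of_pos ht]
  have h5 : sphereProj (x + t • radialVector x) = sphereProj x := by
    rw [sphereProj, h4, h3, inv_smul_smul₀ ht.ne']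
  rw [surfaceFunction, h4, h5, PiLp.add_apply, PiLp.smul_apply, radialVector_apply_three,
    smul_eq_mul]

lemma contDiff_quadric (i : Fin n) : ContDiff ℝ ∞ (B.quadric i) := by
  have h1 := contDiff_apply_three
  have h2 := contDiff_inner_const (B.center i)
  exact ((h1.pow 2).add (h2.pow 2)).sub (contDiff_const.mul (contDiff_const.sub (h1.pow 2)))

/-- The direction is the component of the centre tangent to the sphere at `x`: along it `x 3` stays
zero while the product with the centre grows at rate `1 - a ^ 2`. -/
lemma fderiv_quadric_ne_zero {i : Fin n} {x : E4} (hx : x ∈ sphereTwo)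
    (h : ⟪x, B.center i⟫ = B.height i) :
    fderiv ℝ (B.quadric i) x (B.center i - B.height i • x) ≠ 0 := by
  set a := B.height i with ha
  have ha0 : 0 < a := B.height_pos i
  have ha1 : a < 1 := B.height_lt_one i
  have hd : DifferentiableAt ℝ (B.quadric i) x :=
    (B.contDiff_quadric i).contDiffAt.differentiableAt (by simp)
  have key : HasLineDerivAt ℝ (B.quadric i) (2 * a * (1 - a ^ 2)) x (B.center i - a • x) := by
    have h1 : HasDerivAt (fun t : ℝ => (a + t * (1 - a ^ 2)) ^ 2 - a ^ 2)
        (2 * a * (1 - a ^ 2)) 0 := by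
      have e1 : HasDerivAt (fun t : ℝ => a + t * (1 - a ^ 2)) (1 * (1 - a ^ 2)) 0 :=
        ((hasDerivAt_id (0 : ℝ)).mul_const _).const_add _
      refine ((e1.pow 2).sub_const (a ^ 2)).congr_deriv ?_
      simp
    refine h1.congr_of_eventuallyEq (Eventually.of_forall fun t => ?_)
    have h3 : (x + t • (B.center i - a • x)) 3 = 0 := by
      simp [hx.2, B.center_apply_three i]
    dsimp only
    rw [quadric, h3, inner_add_left, inner_smul_left, inner_sub_left, inner_smul_left,
      real_inner_self_eq_norm_sq, h, B.norm_center]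
    simp only [conj_trivial]
    ring
  rw [← hd.lineDeriv_eq_fderiv, key.lineDeriv]
  have : 0 < 1 - a ^ 2 := by nlinarith
  positivity

/-! ### Smoothness, transversality and projection of the surface -/

lemma tableFunction_nonneg_of_mem {x : E4} (hx : x ∈ B.doubleSurface δ) :
    0 ≤ B.tableFunction δ (sphereProj x) := by
  have := norm_pos_iff.2 hx.2.1
  have h2 : 0 ≤ ‖horizontal x‖ ^ 2 * B.tableFunction δ (sphereProj x) := hx.2.2 ▸ sq_nonneg _
  exact nonneg_of_mul_nonneg_right h2 (by positivity)

lemma sphereProj_mem_domain (hδ : B.IsMargin δ) {x : E4} (hx : x ∈ B.doubleSurface δ) :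
    sphereProj x ∈ B.domain := by
  have h1 := sphereProj_mem_sphereTwo hx.2.1
  exact B.mem_domain_iff.2
    ⟨h1, (B.tableFunction_nonneg_iff hδ h1).1 (B.tableFunction_nonneg_of_mem hx)⟩

/-- The points of the surface which lie on the great sphere are those above the boundary. -/
lemma apply_three_eq_zero_iff (hδ : B.IsMargin δ) {x : E4} (hx : x ∈ B.doubleSurface δ) :
    x 3 = 0 ↔ ∃ i, ⟪sphereProj x, B.center i⟫ = B.height i := by
  have h1 := sphereProj_mem_sphereTwo hx.2.1
  have h2 := (B.mem_domain_iff.1 (B.sphereProj_mem_domain hδ hx)).2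
  have h3 := norm_pos_iff.2 hx.2.1
  have h4 : x 3 = 0 ↔ B.tableFunction δ (sphereProj x) = 0 := by
    rw [← sq_eq_zero_iff, hx.2.2, mul_eq_zero_iff_left (by positivity)]
  have h5 : B.tableFunction δ (sphereProj x) = 0 ↔ ¬ 0 < B.tableFunction δ (sphereProj x) :=
    ⟨fun h => h.le.not_gt, fun h => le_antisymm (not_lt.1 h) (B.tableFunction_nonneg_of_mem hx)⟩
  rw [h4, h5, B.tableFunction_pos_iff hδ h1, not_forall]
  exact exists_congr fun i => ⟨fun h => le_antisymm (h2 i) (not_lt.1 h), fun h => h.not_lt⟩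

lemma mem_sphereTwo_of_mem_boundary (hδ : B.IsMargin δ) {x : E4} (hx : x ∈ B.doubleSurface δ)
    (h : x 3 = 0) : x ∈ sphereTwo ∧ ∃ i, ⟪x, B.center i⟫ = B.height i := by
  have h1 : x ∈ sphereTwo := ⟨hx.1, h⟩
  have := (B.apply_three_eq_zero_iff hδ hx).1 h
  rw [sphereProj_of_mem_sphereTwo h1] at this
  exact ⟨h1, this⟩

/-- Over the boundary of the table the quadric is a regular equation. Elsewhere `x 3 ≠ 0`, and the
global equation has nonzero derivative along the fibre. -/
theorem isSmoothSurface_doubleSurface (hδ : B.IsMargin δ) :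
    IsSmoothSurface (B.doubleSurface δ) := by
  refine ⟨fun x hx => hx.1, fun x hx => ?_⟩
  by_cases h3 : x 3 = 0
  · obtain ⟨h1, i, hi⟩ := B.mem_sphereTwo_of_mem_boundary hδ hx h3
    refine ⟨B.collar δ i, B.quadric i, B.isOpen_collar δ i, B.mem_collar_of_inner_eq hδ h1 hi,
      (B.contDiff_quadric i).contDiffOn, ?_, B.center i - B.height i • x, ?_,
      B.fderiv_quadric_ne_zero h1 hi⟩
    · ext y
      refine ⟨fun h => ?_, fun h => ?_⟩
      · have := (B.mem_doubleSurface_iff_of_mem_collar hδ h.2).1 h.1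
        exact ⟨this.1, h.2, this.2⟩
      · exact ⟨(B.mem_doubleSurface_iff_of_mem_collar hδ h.2.1).2 ⟨h.1, h.2.2⟩, h.2.1⟩
    · rw [inner_sub_right, inner_smul_right, real_inner_self_eq_norm_sq,
        norm_eq_one_of_mem_sphereTwo h1, hi]
      ring
  · refine ⟨{y | horizontal y ≠ 0}, B.surfaceFunction δ, isOpen_horizontal_ne_zero, hx.2.1,
      fun y hy => (B.contDiffAt_surfaceFunction hy).contDiffWithinAt, ?_, radialVector x,
      inner_radialVector hx.2.1, ?_⟩
    · ext y
      refine ⟨fun h => ?_, fun h => ?_⟩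
      · exact ⟨h.1.1, h.2, B.surfaceFunction_eq_zero_iff.2 h.1.2.2⟩
      · exact ⟨⟨h.1, h.2.1, B.surfaceFunction_eq_zero_iff.1 h.2.2⟩, h.2.1⟩
    · rw [B.fderiv_surfaceFunction_radialVector hx.2.1]
      have h4 := B.tableFunction_nonneg_of_mem hx
      have h5 := norm_ne_zero_iff.2 hx.2.1
      have h6 : 1 + B.tableFunction δ (sphereProj x) ≠ 0 := by positivity
      exact mul_ne_zero (mul_ne_zero (mul_ne_zero two_ne_zero h3) h5) h6

/-- The derivative of the defining function vanishes on every tangent vector, but not on the radial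
vector when `x 3 ≠ 0`. -/
theorem transversality_doubleSurface (hδ : B.IsMargin δ) :
    B.Transversality (B.doubleSurface δ) := by
  rintro x hx hb ⟨γ, hγ, hS, h0, hv⟩
  have h3 : x 3 ≠ 0 := fun h => hb <| B.mem_boundary_domain_iff.2
    ⟨B.sphereProj_mem_domain hδ hx, (B.apply_three_eq_zero_iff hδ hx).1 h⟩
  have hd : DifferentiableAt ℝ (B.surfaceFunction δ) (γ 0) := by
    rw [h0]
    exact (B.contDiffAt_surfaceFunction hx.2.1).differentiableAt (by simp)
  have hγd : HasDerivAt γ (radialVector x) 0 := by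
    rw [← hv]
    exact (hγ.differentiableAt (by simp)).hasDerivAt
  have h1 := hd.hasFDerivAt.comp_hasDerivAt 0 hγd
  have h2 : HasDerivAt (B.surfaceFunction δ ∘ γ) 0 0 := by
    refine (hasDerivAt_const (0 : ℝ) (0 : ℝ)).congr_of_eventuallyEq ?_
    filter_upwards [hS] with t ht
    exact B.surfaceFunction_eq_zero_iff.2 ht.2.2
  have h4 := h1.unique h2
  rw [h0, B.fderiv_surfaceFunction_radialVector hx.2.1] at h4
  have h5 := B.tableFunction_nonneg_of_mem hx
  have h6 := norm_ne_zero_iff.2 hx.2.1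
  have h7 : 1 + B.tableFunction δ (sphereProj x) ≠ 0 := by positivity
  exact mul_ne_zero (mul_ne_zero (mul_ne_zero two_ne_zero h3) h6) h7 h4

theorem sphereProj_image_doubleSurface (hδ : B.IsMargin δ) :
    sphereProj '' B.doubleSurface δ = B.domain := by
  refine Subset.antisymm ?_ fun z hz => ?_
  · rintro _ ⟨x, hx, rfl⟩
    exact B.sphereProj_mem_domain hδ hx
  · obtain ⟨hz2, hz⟩ := B.mem_domain_iff.1 hz
    have hP := (B.tableFunction_nonneg_iff hδ hz2).2 hz
    exact ⟨fiberPoint z (√(B.tableFunction δ z)),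
      B.fiberPoint_mem_doubleSurface hz2 (Real.sq_sqrt hP), sphereProj_fiberPoint hz2 _⟩

lemma ne_pole_of_mem_doubleSurface {x : E4} (hx : x ∈ B.doubleSurface δ) :
    x ≠ pole ∧ x ≠ -pole := by
  constructor <;> rintro rfl
  · exact hx.2.1 horizontal_pole
  · refine hx.2.1 ?_
    rw [← neg_one_smul ℝ pole, horizontal_smul, horizontal_pole, smul_zero]

/-! ### Symmetry -/

/-- In the collar, membership depends only on `‖x‖`, `x 3 ^ 2` and `⟪x, B.center i⟫`, which both the
inversion and the rotations preserve. -/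
lemma mem_collar_inter_iff_of_eq (hδ : B.IsMargin δ) {i : Fin n} {x y : E4} (h1 : ‖y‖ = ‖x‖)
    (h2 : y 3 ^ 2 = x 3 ^ 2) (h3 : ⟪y, B.center i⟫ = ⟪x, B.center i⟫) :
    y ∈ B.collar δ i ∩ B.doubleSurface δ ↔ x ∈ B.collar δ i ∩ B.doubleSurface δ := by
  have h4 : ‖horizontal y‖ = ‖horizontal x‖ := by
    rw [← sq_eq_sq₀ (norm_nonneg _) (norm_nonneg _), norm_horizontal_sq, norm_horizontal_sq, h1, h2]
  have h5 : y ∈ B.collar δ i ↔ x ∈ B.collar δ i := by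
    change (B.height i - δ / 2) * ‖horizontal y‖ < ⟪y, B.center i⟫ ↔
      (B.height i - δ / 2) * ‖horizontal x‖ < ⟪x, B.center i⟫
    rw [h3, h4]
  rw [mem_inter_iff, mem_inter_iff, h5]
  refine and_congr_right fun hx => ?_
  rw [B.mem_doubleSurface_iff_of_mem_collar hδ hx,
    B.mem_doubleSurface_iff_of_mem_collar hδ (h5.2 hx), mem_sphereThree, mem_sphereThree, h1,
    quadric, quadric, h2, h3]

lemma mem_doubleSurface_of_inner_eq (hδ : B.IsMargin δ) {i : Fin n} {x : E4} (hx : x ∈ sphereTwo)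
    (h : ⟪x, B.center i⟫ = B.height i) : x ∈ B.doubleSurface δ := by
  rw [B.mem_doubleSurface_iff_of_mem_collar hδ (B.mem_collar_of_inner_eq hδ hx h), quadric, h, hx.2]
  exact ⟨hx.1, by ring⟩

lemma sphereInversion_sphereInversion (x : E4) : sphereInversion (sphereInversion x) = x := by
  have h : sphereInversion x 3 = - x 3 := by
    simp [sphereInversion, pole_apply_three]
    ring
  rw [sphereInversion, h, sphereInversion]
  simp

theorem symmetry_doubleSurface (hδ : B.IsMargin δ) : B.Symmetry (B.doubleSurface δ) := by
  intro i
  refine ⟨fun x hx => ?_, B.collar δ i ∩ B.doubleSurface δ, inter_subset_right,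
    ⟨B.collar δ i, B.isOpen_collar δ i, fun x hx => ?_, Subset.rfl⟩, ?_, fun R hR => ?_⟩
  · obtain ⟨h1, h2⟩ := B.boundary_obstacle_subset hx
    exact B.mem_doubleSurface_of_inner_eq hδ h1 h2
  · obtain ⟨h1, h2⟩ := B.boundary_obstacle_subset hx
    exact B.mem_collar_of_inner_eq hδ h1 h2
  · have key : ∀ x, sphereInversion x ∈ B.collar δ i ∩ B.doubleSurface δ ↔
        x ∈ B.collar δ i ∩ B.doubleSurface δ := by
      intro x
      refine B.mem_collar_inter_iff_of_eq hδ ?_ ?_ ?_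
      · rw [← sq_eq_sq₀ (norm_nonneg _) (norm_nonneg _), sphereInversion, norm_sub_sq_real,
          inner_smul_right, inner_pole, norm_smul, norm_pole, Real.norm_eq_abs, mul_one, sq_abs]
        ring
      · simp [sphereInversion, pole_apply_three]
        ring
      · rw [sphereInversion, inner_sub_left, inner_smul_left, inner_pole_left,
          B.center_apply_three]
        simp
    ext y
    constructor
    · rintro ⟨x, hx, rfl⟩
      exact (key x).2 hx
    · intro hy
      refine ⟨sphereInversion y, (key y).2 hy, sphereInversion_sphereInversion y⟩
  · obtain ⟨hp, hc, -⟩ := hR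
    have key : ∀ x, R x ∈ B.collar δ i ∩ B.doubleSurface δ ↔
        x ∈ B.collar δ i ∩ B.doubleSurface δ := by
      intro x
      refine B.mem_collar_inter_iff_of_eq hδ (R.norm_map x) ?_ ?_
      · rw [← inner_pole, ← inner_pole x, ← hp, R.inner_map_map, hp]
      · conv_lhs => rw [← hc]
        rw [R.inner_map_map]
    ext y
    constructor
    · rintro ⟨x, hx, rfl⟩
      exact (key x).2 hx
    · intro hy
      refine ⟨R.symm y, ?_, R.apply_symm_apply y⟩
      rwa [← key, R.apply_symm_apply]

end SphericalBilliard

/-! ### Curvature -/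

namespace SphericalBilliard

variable {n : ℕ} (B : SphericalBilliard n) {δ : ℝ}

/-- The quadratic form which defines the surface near the boundary of the `i`-th obstacle, as a
symmetric operator. -/
noncomputable def collarOperator (i : Fin n) : E4 →L[ℝ] E4 :=
  (innerSL ℝ (B.center i)).smulRight (B.center i) +
    (1 + B.height i ^ 2) • (innerSL ℝ pole).smulRight pole

lemma inner_collarOperator (i : Fin n) (x y : E4) : ⟪x, B.collarOperator i y⟫ =
    ⟪x, B.center i⟫ * ⟪y, B.center i⟫ + (1 + B.height i ^ 2) * (x 3 * y 3) := by
  simp only [collarOperator, add_apply, smul_apply,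
    ContinuousLinearMap.smulRight_apply, innerSL_apply_apply, inner_add_right, inner_smul_right,
    inner_pole, inner_pole_left, real_inner_comm y (B.center i)]
  ring

lemma collarOperator_symmetric (i : Fin n) (x y : E4) :
    ⟪B.collarOperator i x, y⟫ = ⟪x, B.collarOperator i y⟫ := by
  rw [real_inner_comm, inner_collarOperator, inner_collarOperator]
  ring

/-- Relations between the derivatives of a curve on the surface through a point of the boundary. -/
lemma curve_relations (hδ : B.IsMargin δ) {i : Fin n} {x v : E4} (hx : x ∈ sphereTwo)
    (h : ⟪x, B.center i⟫ = B.height i) {γ : ℝ → E4}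
    (hγ : IsCurveThrough (B.doubleSurface δ) x v γ) :
    ⟪v, x⟫ = 0 ∧ ⟪v, B.center i⟫ = 0 ∧ ⟪v, v⟫ + ⟪deriv (deriv γ) 0, x⟫ = 0 ∧
      (1 + B.height i ^ 2) * v 3 ^ 2 + B.height i * ⟪deriv (deriv γ) 0, B.center i⟫ = 0 := by
  obtain ⟨hs, hS, h0, hv⟩ := hγ
  have ha := B.height_pos i
  have hcol : ∀ᶠ t in 𝓝 (0 : ℝ), γ t ∈ B.collar δ i := by
    refine hs.continuousAt.preimage_mem_nhds ((B.isOpen_collar δ i).mem_nhds ?_)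
    rw [h0]
    exact B.mem_collar_of_inner_eq hδ hx h
  -- Two quadratic forms are constant along the curve: the squared norm, because it lies on the
  -- sphere, and the form of the quadric.
  have q1 : ∀ᶠ t in 𝓝 (0 : ℝ), ⟪γ t, ContinuousLinearMap.id ℝ E4 (γ t)⟫ = 1 := by
    filter_upwards [hS] with t ht
    rw [ContinuousLinearMap.id_apply, real_inner_self_eq_norm_sq, mem_sphereThree.1 ht.1, one_pow]
  have q2 : ∀ᶠ t in 𝓝 (0 : ℝ), ⟪γ t, B.collarOperator i (γ t)⟫ = B.height i ^ 2 := by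
    filter_upwards [hS, hcol] with t ht hc
    have := ((B.mem_doubleSurface_iff_of_mem_collar hδ hc).1 ht).2
    rw [quadric] at this
    rw [inner_collarOperator]
    linarith
  obtain ⟨r1, r2⟩ := deriv_quadratic_const hs (ContinuousLinearMap.id ℝ E4) (fun _ _ => rfl) q1
  obtain ⟨r3, r4⟩ := deriv_quadratic_const hs _ (B.collarOperator_symmetric i) q2
  rw [h0, hv, ContinuousLinearMap.id_apply] at r1
  rw [h0, hv, ContinuousLinearMap.id_apply, ContinuousLinearMap.id_apply] at r2
  rw [h0, hv, inner_collarOperator, hx.2, h] at r3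
  rw [h0, hv, inner_collarOperator, inner_collarOperator, hx.2, h] at r4
  have r5 : ⟪v, B.center i⟫ = 0 := by
    have : ⟪v, B.center i⟫ * B.height i = 0 := by linarith
    exact (mul_eq_zero.1 this).resolve_right ha.ne'
  refine ⟨r1, r5, r2, ?_⟩
  rw [r5] at r4
  linarith

/-- The unit normal along the boundary of the `i`-th obstacle. -/
noncomputable def boundaryNormal (i : Fin n) (x : E4) : E4 :=
  (√(1 - B.height i ^ 2))⁻¹ • (B.center i - B.height i • x)

lemma one_sub_height_sq_pos (i : Fin n) : 0 < 1 - B.height i ^ 2 := by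
  have := B.height_pos i
  have := B.height_lt_one i
  nlinarith

lemma norm_center_sub {i : Fin n} {x : E4} (hx : x ∈ sphereTwo)
    (h : ⟪x, B.center i⟫ = B.height i) :
    ‖B.center i - B.height i • x‖ = √(1 - B.height i ^ 2) := by
  rw [← Real.sqrt_sq (norm_nonneg (B.center i - B.height i • x)), norm_sub_sq_real,
    inner_smul_right, real_inner_comm, h, norm_smul, B.norm_center,
    norm_eq_one_of_mem_sphereTwo hx, Real.norm_eq_abs, mul_one, sq_abs]
  congr 1
  ring

lemma isUnitNormal_boundaryNormal (hδ : B.IsMargin δ) {i : Fin n} {x : E4} (hx : x ∈ sphereTwo)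
    (h : ⟪x, B.center i⟫ = B.height i) :
    IsUnitNormal (B.doubleSurface δ) x (B.boundaryNormal i x) := by
  have hs := Real.sqrt_pos.2 (B.one_sub_height_sq_pos i)
  refine ⟨?_, ?_, ?_⟩
  · rw [boundaryNormal, norm_smul, B.norm_center_sub hx h, norm_inv, Real.norm_eq_abs,
      abs_of_pos hs, inv_mul_cancel₀ hs.ne']
  · rw [boundaryNormal, inner_smul_right, inner_sub_right, inner_smul_right, h,
      real_inner_self_eq_norm_sq, norm_eq_one_of_mem_sphereTwo hx]
    ring
  · rintro v ⟨γ, hγ⟩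
    obtain ⟨r1, r2, -, -⟩ := B.curve_relations hδ hx h hγ
    rw [boundaryNormal, inner_smul_right, inner_sub_right, inner_smul_right, r1, r2]
    ring

/-- Such functions are the horizontal coefficients of the vertical curve below; as they are
stationary at `0`, its velocity there is the pole. -/
lemma hasDerivAt_sqrt_add_mul_sq {a : ℝ} (ha : 0 < a) (b : ℝ) :
    HasDerivAt (fun t : ℝ => √(a + b * t ^ 2)) 0 0 ∧
      ContDiffAt ℝ ∞ (fun t : ℝ => √(a + b * t ^ 2)) 0 := by
  have h0 : a + b * (0 : ℝ) ^ 2 ≠ 0 := by simpa using ha.ne'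
  constructor
  · have h1 : HasDerivAt (fun t : ℝ => a + b * t ^ 2) 0 0 := by
      simpa using ((hasDerivAt_pow 2 (0 : ℝ)).const_mul b).const_add a
    simpa using h1.sqrt h0
  · exact ContDiffAt.sqrt (by fun_prop) h0

/-- The vertical curve on the surface through a point of the boundary. -/
lemma pole_mem_tangentSpaceAt (hδ : B.IsMargin δ) {i : Fin n} {x : E4} (hx : x ∈ sphereTwo)
    (h : ⟪x, B.center i⟫ = B.height i) : pole ∈ tangentSpaceAt (B.doubleSurface δ) x := by
  set a := B.height i with ha
  have ha0 : 0 < a := B.height_pos i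
  have ha1 : 0 < 1 - a ^ 2 := B.one_sub_height_sq_pos i
  have hs := Real.sqrt_pos.2 ha1
  have hs2 : √(1 - a ^ 2) ^ 2 = 1 - a ^ 2 := Real.sq_sqrt ha1.le
  set c := B.center i with hc
  have hx1 := norm_eq_one_of_mem_sphereTwo hx
  have hc1 : ⟪c, c⟫ = 1 := by rw [real_inner_self_eq_norm_sq, B.norm_center, one_pow]
  have hc3 : c 3 = 0 := B.center_apply_three i
  -- With `c` and the pole, `e` is an orthonormal basis of a space containing `x`. In `t • pole + u
  -- • c + w • e`, the quadric forces `u ^ 2 = a ^ 2 - (1 + a ^ 2) * t ^ 2`, and the unit norm then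
  -- forces `w ^ 2 = 1 - a ^ 2 + a ^ 2 * t ^ 2`.
  set e : E4 := (√(1 - a ^ 2))⁻¹ • (x - a • c) with he
  have hec : ⟪e, c⟫ = 0 := by
    rw [he, inner_smul_left, inner_sub_left, inner_smul_left, h, hc1]
    simp
  have he3 : e 3 = 0 := by simp [he, hx.2, hc3]
  have hxe : x = a • c + √(1 - a ^ 2) • e := by
    rw [he, smul_inv_smul₀ hs.ne', add_sub_cancel]
  have he1 : ⟪e, e⟫ = 1 := by
    have h1 : ⟪x, e⟫ = √(1 - a ^ 2) := by
      rw [he, inner_smul_right, inner_sub_right, inner_smul_right, h, real_inner_self_eq_norm_sq,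
        hx1, inv_mul_eq_div, div_eq_iff hs.ne']
      linear_combination -hs2
    rw [hxe, inner_add_left, inner_smul_left, inner_smul_left, real_inner_comm, hec] at h1
    simp only [conj_trivial, mul_zero, zero_add] at h1
    exact mul_left_cancel₀ hs.ne' (by rw [h1, mul_one])
  set u : ℝ → ℝ := fun t => √(a ^ 2 + (-(1 + a ^ 2)) * t ^ 2) with hu
  set w : ℝ → ℝ := fun t => √((1 - a ^ 2) + a ^ 2 * t ^ 2) with hw
  obtain ⟨hud, hus⟩ := hasDerivAt_sqrt_add_mul_sq (a := a ^ 2) (by positivity) (-(1 + a ^ 2))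
  obtain ⟨hwd, hws⟩ := hasDerivAt_sqrt_add_mul_sq ha1 (a ^ 2)
  set γ : ℝ → E4 := fun t => t • pole + u t • c + w t • e with hγ
  have hγs : ContDiffAt ℝ ∞ γ 0 :=
    ((contDiffAt_id.smul contDiffAt_const).add (hus.smul contDiffAt_const)).add
      (hws.smul contDiffAt_const)
  have hγ0 : γ 0 = x := by
    simp only [hγ, hu, hw]
    rw [hxe]
    simp [Real.sqrt_sq ha0.le]
  have hγd : HasDerivAt γ pole 0 := by
    refine ((((hasDerivAt_id (0 : ℝ)).smul_const pole).add (hud.smul_const c)).add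
      (hwd.smul_const e)).congr_deriv ?_
    simp
  refine ⟨γ, hγs, ?_, hγ0, hγd.deriv⟩
  have hcol : ∀ᶠ t in 𝓝 (0 : ℝ), γ t ∈ B.collar δ i := by
    refine hγs.continuousAt.preimage_mem_nhds ((B.isOpen_collar δ i).mem_nhds ?_)
    rw [hγ0]
    exact B.mem_collar_of_inner_eq hδ hx h
  have hpos : ∀ᶠ t in 𝓝 (0 : ℝ), 0 < a ^ 2 + (-(1 + a ^ 2)) * t ^ 2 := by
    have : ContinuousAt (fun t : ℝ => a ^ 2 + (-(1 + a ^ 2)) * t ^ 2) 0 := by fun_prop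
    exact this.eventually_const_lt (by simpa using pow_pos ha0 2)
  filter_upwards [hcol, hpos] with t ht hp
  have hu2 : u t ^ 2 = a ^ 2 + (-(1 + a ^ 2)) * t ^ 2 := Real.sq_sqrt hp.le
  have hw2 : w t ^ 2 = (1 - a ^ 2) + a ^ 2 * t ^ 2 := Real.sq_sqrt (by positivity)
  have h3 : γ t 3 = t := by simp [hγ, pole_apply_three, hc3, he3]
  have hγc : ⟪γ t, c⟫ = u t := by
    simp only [hγ, inner_add_left, inner_smul_left, inner_pole_left, hc3, hc1, hec]
    simp
  have hγe : ⟪γ t, e⟫ = w t := by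
    simp only [hγ, inner_add_left, inner_smul_left, inner_pole_left, he3, he1,
      real_inner_comm e c, hec]
    simp
  refine (B.mem_doubleSurface_iff_of_mem_collar hδ ht).2 ⟨mem_sphereThree.2 ?_, ?_⟩
  · have h1 : ‖γ t‖ ^ 2 = 1 := by
      rw [← real_inner_self_eq_norm_sq]
      conv_lhs => rw [show γ t = t • pole + u t • c + w t • e from rfl, inner_add_left,
        inner_add_left, inner_smul_left, inner_smul_left, inner_smul_left]
      change t * ⟪pole, γ t⟫ + u t * ⟪c, γ t⟫ + w t * ⟪e, γ t⟫ = 1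
      rw [inner_pole_left, real_inner_comm, real_inner_comm (γ t) e, hγc, hγe, h3]
      nlinarith
    exact (pow_eq_one_iff_of_nonneg (norm_nonneg _) two_ne_zero).1 h1
  · rw [quadric, h3, hγc, hu2]
    ring

theorem nonzeroVerticalCurvature_doubleSurface (hδ : B.IsMargin δ) :
    B.NonzeroVerticalCurvature (B.doubleSurface δ) := by
  intro x hx hb
  have h3 := (B.apply_three_eq_zero_iff hδ hx).2 (B.mem_boundary_domain_iff.1 hb).2
  obtain ⟨hx2, i, hi⟩ := B.mem_sphereTwo_of_mem_boundary hδ hx h3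
  have ha0 := B.height_pos i
  have hs := Real.sqrt_pos.2 (B.one_sub_height_sq_pos i)
  rw [radialVector_of_mem_sphereTwo hx2]
  -- With `a = B.height i` and vertical velocity, `curve_relations` gives an acceleration with
  -- components `-1` along `x` and `-(1 + a ^ 2) / a` along the centre, hence `-1 / (a * √(1 - a ^
  -- 2))` along the normal.
  refine ⟨B.boundaryNormal i x, -((√(1 - B.height i ^ 2))⁻¹ * (B.height i)⁻¹),
    B.isUnitNormal_boundaryNormal hδ hx2 hi,
    ⟨B.pole_mem_tangentSpaceAt hδ hx2 hi, fun γ hγ => ?_⟩, by simp [hs.ne', ha0.ne']⟩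
  obtain ⟨-, -, r1, r2⟩ := B.curve_relations hδ hx2 hi hγ
  rw [pole_apply_three] at r2
  rw [real_inner_self_eq_norm_sq, norm_pole] at r1
  rw [boundaryNormal, inner_smul_right, inner_sub_right, inner_smul_right, ← mul_neg]
  congr 1
  field_simp
  linear_combination r2 - B.height i ^ 2 * r1

end SphericalBilliard

/-! ### Stereographic projection of the great sphere -/

/-- An orthonormal basis of `ℝ⁴` which ends with a given point of the great sphere and the pole. -/
lemma exists_adapted_basis {c : E4} (hc : c ∈ sphereTwo) :
    ∃ b : OrthonormalBasis (Fin 4) ℝ E4, b 2 = c ∧ b 3 = pole := by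
  have hc1 := norm_eq_one_of_mem_sphereTwo hc
  -- The two zeros are placeholders: only the indices `2` and `3` are prescribed.
  have ho : Orthonormal ℝ (({2, 3} : Set (Fin 4)).domRestrict ![0, 0, c, pole]) := by
    constructor
    · rintro ⟨i, hi⟩
      rcases hi with rfl | rfl
      · simpa using hc1
      · simpa using norm_pole
    · rintro ⟨i, hi⟩ ⟨j, hj⟩ hij
      rcases hi with rfl | rfl <;> rcases hj with rfl | rfl
      · exact absurd rfl hij
      · simpa using (inner_pole c).trans hc.2
      · simpa using (inner_pole_left c).trans hc.2
      · exact absurd rfl hij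
  obtain ⟨b, hb⟩ := ho.exists_orthonormalBasis_extension_of_card_eq (by simp)
  exact ⟨b, hb 2 (by simp), hb 3 (by simp)⟩

section stereographic

variable (b : OrthonormalBasis (Fin 4) ℝ E4)

/-- The inverse of the stereographic projection from `b 2`. -/
noncomputable def stereoInv (w : ℂ) : E4 :=
  (1 + ‖w‖ ^ 2)⁻¹ • ((2 * w.re) • b 0 + (2 * w.im) • b 1 + (‖w‖ ^ 2 - 1) • b 2)

/-- The stereographic projection from `b 2`. -/
noncomputable def stereoProj (z : E4) : ℂ :=
  ((⟪z, b 0⟫ / (1 - ⟪z, b 2⟫) : ℝ) : ℂ) + ((⟪z, b 1⟫ / (1 - ⟪z, b 2⟫) : ℝ) : ℂ) * Complex.I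

lemma inner_stereoInv (w : ℂ) (y : E4) : ⟪stereoInv b w, y⟫ = (1 + ‖w‖ ^ 2)⁻¹ *
    (2 * w.re * ⟪y, b 0⟫ + 2 * w.im * ⟪y, b 1⟫ + (‖w‖ ^ 2 - 1) * ⟪y, b 2⟫) := by
  rw [real_inner_comm]
  simp only [stereoInv, inner_smul_right, inner_add_right]

lemma inner_stereoInv_basis (w : ℂ) :
    ⟪stereoInv b w, b 0⟫ = (1 + ‖w‖ ^ 2)⁻¹ * (2 * w.re) ∧
    ⟪stereoInv b w, b 1⟫ = (1 + ‖w‖ ^ 2)⁻¹ * (2 * w.im) ∧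
    ⟪stereoInv b w, b 2⟫ = (1 + ‖w‖ ^ 2)⁻¹ * (‖w‖ ^ 2 - 1) ∧
    ⟪stereoInv b w, b 3⟫ = 0 := by
  simp [inner_stereoInv]

lemma stereoInv_mem_sphereTwo (hb : b 3 = pole) (w : ℂ) : stereoInv b w ∈ sphereTwo := by
  obtain ⟨h0, h1, h2, h3⟩ := inner_stereoInv_basis b w
  refine ⟨mem_sphereThree.2 ?_, by rw [← inner_pole, ← hb, h3]⟩
  refine (pow_eq_one_iff_of_nonneg (norm_nonneg _) two_ne_zero).1 ?_
  rw [← real_inner_self_eq_norm_sq, inner_stereoInv, h0, h1, h2]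
  have hw : w.re ^ 2 + w.im ^ 2 = ‖w‖ ^ 2 := by
    rw [Complex.sq_norm, Complex.normSq_apply]
    ring
  have : (1 + ‖w‖ ^ 2) ≠ 0 := by positivity
  field_simp
  linear_combination 4 * hw

lemma stereoProj_re (z : E4) : (stereoProj b z).re = ⟪z, b 0⟫ / (1 - ⟪z, b 2⟫) := by
  simp only [stereoProj, Complex.add_re, Complex.mul_re,
    Complex.ofReal_re, Complex.ofReal_im, Complex.I_re, Complex.I_im]
  ring

lemma stereoProj_im (z : E4) : (stereoProj b z).im = ⟪z, b 1⟫ / (1 - ⟪z, b 2⟫) := by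
  simp only [stereoProj, Complex.add_im, Complex.mul_im,
    Complex.ofReal_re, Complex.ofReal_im, Complex.I_re, Complex.I_im]
  ring

lemma stereoProj_stereoInv (w : ℂ) : stereoProj b (stereoInv b w) = w := by
  obtain ⟨h0, h1, h2, h3⟩ := inner_stereoInv_basis b w
  have h : (1 + ‖w‖ ^ 2) ≠ 0 := by positivity
  have h4 : 1 - (1 + ‖w‖ ^ 2)⁻¹ * (‖w‖ ^ 2 - 1) = (1 + ‖w‖ ^ 2)⁻¹ * 2 := by
    field_simp
    ring
  refine Complex.ext ?_ ?_
  · rw [stereoProj_re, h0, h2, h4]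
    field_simp
  · rw [stereoProj_im, h1, h2, h4]
    field_simp

lemma sq_inner_basis_add (hb : b 3 = pole) {z : E4} (hz : z ∈ sphereTwo) :
    ⟪z, b 0⟫ ^ 2 + ⟪z, b 1⟫ ^ 2 + ⟪z, b 2⟫ ^ 2 = 1 := by
  have h := b.sum_sq_norm_inner_left z
  rw [Fin.sum_univ_four, norm_eq_one_of_mem_sphereTwo hz, hb, inner_pole, hz.2] at h
  simpa using h

lemma stereoInv_stereoProj (hb : b 3 = pole) {z : E4} (hz : z ∈ sphereTwo) (h : ⟪z, b 2⟫ < 1) :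
    stereoInv b (stereoProj b z) = z := by
  have hs := sq_inner_basis_add b hb hz
  have hd : 1 - ⟪z, b 2⟫ ≠ 0 := by linarith
  have hn : ‖stereoProj b z‖ ^ 2 = (1 + ⟪z, b 2⟫) / (1 - ⟪z, b 2⟫) := by
    rw [Complex.sq_norm, Complex.normSq_apply, stereoProj_re, stereoProj_im]
    field_simp
    linear_combination hs
  have h1 : 1 + ‖stereoProj b z‖ ^ 2 = 2 / (1 - ⟪z, b 2⟫) := by
    rw [hn]
    field_simp
    ring
  have hz' := b.sum_repr' z
  rw [Fin.sum_univ_four, hb, inner_pole_left, hz.2, zero_smul, add_zero, real_inner_comm,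
    real_inner_comm z (b 1), real_inner_comm z (b 2)] at hz'
  conv_rhs => rw [← hz']
  rw [stereoInv, h1, hn, stereoProj_re, stereoProj_im, smul_add, smul_add, smul_smul, smul_smul,
    smul_smul]
  congr 3
  · field_simp
  · field_simp
  · field_simp
    ring

lemma continuous_stereoInv : Continuous (stereoInv b) := by
  have h1 := Complex.continuous_re
  have h2 := Complex.continuous_im
  have h3 : ∀ w : ℂ, 1 + ‖w‖ ^ 2 ≠ 0 := fun w => by positivity
  unfold stereoInv
  fun_prop (disch := assumption)

end stereographic

lemma continuousAt_sphereProj {x : E4} (hx : horizontal x ≠ 0) : ContinuousAt sphereProj x := by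
  have h1 := continuous_horizontal.continuousAt (x := x)
  exact (h1.norm.inv₀ (norm_ne_zero_iff.2 hx)).smul h1

/-- The hypothesis is applied to the point of the disk farthest from the origin, which lies on the
ray through `p`; if `p = 0`, any boundary point serves. -/
lemma norm_add_lt_of_closedBall_subset {p : ℂ} {r R : ℝ} (hr : 0 ≤ r)
    (h : ∀ w, ‖w - p‖ ≤ r → ‖w‖ < R) : ‖p‖ + r < R := by
  rcases eq_or_ne p 0 with rfl | hp
  · have := h r (by simp [abs_of_nonneg hr])
    simpa [abs_of_nonneg hr] using this
  · have hn := norm_pos_iff.2 hp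
    have := h ((1 + r / ‖p‖) • p) (by
      rw [add_smul, one_smul, add_sub_cancel_left, norm_smul, Real.norm_eq_abs,
        abs_of_nonneg (by positivity), div_mul_cancel₀ _ hn.ne'])
    rwa [norm_smul, Real.norm_eq_abs, abs_of_nonneg (by positivity), add_mul, one_mul,
      div_mul_cancel₀ _ hn.ne'] at this

/-! ### The genus of the surface -/

namespace SphericalBilliard

section planar

variable {n : ℕ} (B : SphericalBilliard n) (b : OrthonormalBasis (Fin 4) ℝ E4)

/-- The radius of the stereographic projection of the boundary of the `i`-th obstacle. -/
noncomputable def planarRadius (i : Fin n) : ℝ :=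
  √(1 - B.height i ^ 2) / (B.height i - ⟪B.center i, b 2⟫)

/-- The centre of the stereographic projection of the boundary of the `i`-th obstacle. -/
noncomputable def planarCenter (i : Fin n) : ℂ :=
  ⟨⟪B.center i, b 0⟫ / (B.height i - ⟪B.center i, b 2⟫),
    ⟪B.center i, b 1⟫ / (B.height i - ⟪B.center i, b 2⟫)⟩

variable {b}

/-- Stereographic projection maps circles to circles, in explicit form. The prefactor is positive
because the projection centre `b 2` lies outside the closed obstacle, so the obstacle becomes a
round disk. -/
lemma height_sub_inner_stereoInv (hb : b 3 = pole) {i : Fin n}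
    (h : ⟪B.center i, b 2⟫ < B.height i) (w : ℂ) :
    B.height i - ⟪stereoInv b w, B.center i⟫ =
      (B.height i - ⟪B.center i, b 2⟫) * (1 + ‖w‖ ^ 2)⁻¹ *
        (‖w - B.planarCenter b i‖ ^ 2 - B.planarRadius b i ^ 2) := by
  have hs := sq_inner_basis_add b hb (B.center_mem i)
  have hd : B.height i - ⟪B.center i, b 2⟫ ≠ 0 := by linarith
  have hw : w.re ^ 2 + w.im ^ 2 = ‖w‖ ^ 2 := by
    rw [Complex.sq_norm, Complex.normSq_apply]
    ring
  have hw0 : 1 + ‖w‖ ^ 2 ≠ 0 := by positivity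
  rw [inner_stereoInv, planarRadius, div_pow, Real.sq_sqrt (B.one_sub_height_sq_pos i).le,
    Complex.sq_norm (w - _), Complex.normSq_apply, Complex.sub_re, Complex.sub_im, planarCenter]
  dsimp only
  set N := ‖w‖ ^ 2
  field_simp
  linear_combination (-(B.height i - ⟪B.center i, b 2⟫) ^ 2) * hw - hs

lemma planarRadius_pos {i : Fin n} (h : ⟪B.center i, b 2⟫ < B.height i) :
    0 < B.planarRadius b i :=
  div_pos (Real.sqrt_pos.2 (B.one_sub_height_sq_pos i)) (sub_pos.2 h)

lemma inner_stereoInv_lt_iff (hb : b 3 = pole) {i : Fin n}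
    (h : ⟪B.center i, b 2⟫ < B.height i) (w : ℂ) :
    ⟪stereoInv b w, B.center i⟫ < B.height i ↔ B.planarRadius b i < ‖w - B.planarCenter b i‖ := by
  have h1 := sub_pos.2 h
  rw [← sub_pos, B.height_sub_inner_stereoInv hb h, mul_pos_iff_of_pos_left (by positivity),
    sub_pos, sq_lt_sq₀ (B.planarRadius_pos h).le (norm_nonneg _)]

lemma inner_stereoInv_le_iff (hb : b 3 = pole) {i : Fin n}
    (h : ⟪B.center i, b 2⟫ < B.height i) (w : ℂ) :
    ⟪stereoInv b w, B.center i⟫ ≤ B.height i ↔ B.planarRadius b i ≤ ‖w - B.planarCenter b i‖ := by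
  have h1 := sub_pos.2 h
  rw [← sub_nonneg, B.height_sub_inner_stereoInv hb h, mul_nonneg_iff_of_pos_left (by positivity),
    sub_nonneg, sq_le_sq₀ (B.planarRadius_pos h).le (norm_nonneg _)]

variable (b)

/-- The surface is the double of the stereographic projection of the billiard table from a point
outside of the table. -/
noncomputable def doubleSurfaceHomeomorph {δ : ℝ} (hδ : B.IsMargin δ) (hb : b 3 = pole)
    (h2 : ∀ z ∈ B.domain, ⟪z, b 2⟫ < 1) :
    B.doubleSurface δ ≃ₜ doubleSet fun w : ℂ => B.tableFunction δ (stereoInv b w) where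
  toFun x := ⟨(stereoProj b (sphereProj x), x.1 3 / ‖horizontal x‖), by
    have hd := B.sphereProj_mem_domain hδ x.2
    have hn := norm_ne_zero_iff.2 x.2.2.1
    change _ ^ 2 = B.tableFunction δ (stereoInv b (stereoProj b (sphereProj x)))
    rw [stereoInv_stereoProj b hb hd.1 (h2 _ hd), div_pow, x.2.2.2,
      mul_div_cancel_left₀ _ (pow_ne_zero 2 hn)]⟩
  invFun p := ⟨fiberPoint (stereoInv b p.1.1) p.1.2,
    B.fiberPoint_mem_doubleSurface (stereoInv_mem_sphereTwo b hb _) p.2⟩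
  left_inv x := by
    have hd := B.sphereProj_mem_domain hδ x.2
    refine Subtype.ext ?_
    dsimp only
    rw [stereoInv_stereoProj b hb hd.1 (h2 _ hd), fiberPoint_sphereProj x.2.1 x.2.2.1]
  right_inv p := by
    have hz := stereoInv_mem_sphereTwo b hb p.1.1
    refine Subtype.ext (Prod.ext ?_ ?_)
    · dsimp only
      rw [sphereProj_fiberPoint hz, stereoProj_stereoInv]
    · dsimp only
      rw [fiberPoint_apply_three hz, norm_horizontal_fiberPoint hz]
      exact mul_div_cancel_left₀ _ (by positivity)
  continuous_toFun := by
    refine Continuous.subtype_mk (continuous_iff_continuousAt.2 fun x => ?_) _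
    have hd := B.sphereProj_mem_domain hδ x.2
    have h1 : 1 - ⟪sphereProj x, b 2⟫ ≠ 0 := by linarith [h2 _ hd]
    have hn := norm_ne_zero_iff.2 x.2.2.1
    have h3 : ContinuousAt (fun y : B.doubleSurface δ => sphereProj (y : E4)) x :=
      (continuousAt_sphereProj x.2.2.1).comp continuous_subtype_val.continuousAt
    have h4 : ContinuousAt (fun y : B.doubleSurface δ => horizontal (y : E4)) x :=
      (continuous_horizontal.comp continuous_subtype_val).continuousAt
    have h5 : ContinuousAt (fun y : B.doubleSurface δ => y.1 3) x :=
      (continuous_apply_three.comp continuous_subtype_val).continuousAt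
    refine ContinuousAt.prodMk ?_ (h5.div h4.norm hn)
    have h6 : ∀ i, ContinuousAt (fun y : B.doubleSurface δ => ⟪sphereProj (y : E4), b i⟫) x :=
      fun i => h3.inner continuousAt_const
    have h7 := (h6 0).div (continuousAt_const.sub (h6 2)) h1
    have h8 := (h6 1).div (continuousAt_const.sub (h6 2)) h1
    exact (Complex.continuous_ofReal.continuousAt.comp h7).add
      ((Complex.continuous_ofReal.continuousAt.comp h8).mul continuousAt_const)
  continuous_invFun := by
    refine Continuous.subtype_mk ?_ _
    have h1 := continuous_stereoInv b
    have h3 : ∀ p : doubleSet fun w : ℂ => B.tableFunction δ (stereoInv b w),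
      √(1 + p.1.2 ^ 2) ≠ 0 := fun p => by positivity
    unfold fiberPoint
    fun_prop (disch := assumption)

end planar

section genus

variable {m : ℕ} (B : SphericalBilliard (m + 1)) {b : OrthonormalBasis (Fin 4) ℝ E4}

lemma inner_center_succ_lt (hb2 : b 2 = B.center 0) (j : Fin m) :
    ⟪B.center j.succ, b 2⟫ < B.height j.succ := by
  rw [hb2, real_inner_comm]
  refine B.inner_lt_height (Fin.succ_ne_zero j).symm (B.center_mem 0) ?_
  rw [real_inner_self_eq_norm_sq, B.norm_center, one_pow]
  exact (B.height_lt_one 0).le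

/-- Here the projection centre is the centre of the obstacle itself, so the sign is reversed: this
obstacle becomes the exterior of a disk around the origin, and its boundary the outer circle. -/
lemma height_zero_sub_inner_stereoInv (hb2 : b 2 = B.center 0) (w : ℂ) :
    B.height 0 - ⟪stereoInv b w, B.center 0⟫ = (1 - B.height 0) * (1 + ‖w‖ ^ 2)⁻¹ *
      (√((1 + B.height 0) / (1 - B.height 0)) ^ 2 - ‖w‖ ^ 2) := by
  have h0 := B.height_pos 0
  have h1 : 0 < 1 - B.height 0 := sub_pos.2 (B.height_lt_one 0)
  rw [← hb2, (inner_stereoInv_basis b w).2.2.1, Real.sq_sqrt (by positivity)]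
  have hw0 : 1 + ‖w‖ ^ 2 ≠ 0 := by positivity
  field_simp
  ring

lemma planarOuter_pos : 0 < √((1 + B.height 0) / (1 - B.height 0)) := by
  have h0 := B.height_pos 0
  have h1 : 0 < 1 - B.height 0 := sub_pos.2 (B.height_lt_one 0)
  positivity

lemma inner_stereoInv_zero_lt_iff (hb2 : b 2 = B.center 0) (w : ℂ) :
    ⟪stereoInv b w, B.center 0⟫ < B.height 0 ↔
      ‖w‖ < √((1 + B.height 0) / (1 - B.height 0)) := by
  have h1 : 0 < 1 - B.height 0 := sub_pos.2 (B.height_lt_one 0)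
  rw [← sub_pos, B.height_zero_sub_inner_stereoInv hb2, mul_pos_iff_of_pos_left (by positivity),
    sub_pos, sq_lt_sq₀ (norm_nonneg _) (Real.sqrt_nonneg _)]

lemma inner_stereoInv_zero_le_iff (hb2 : b 2 = B.center 0) (w : ℂ) :
    ⟪stereoInv b w, B.center 0⟫ ≤ B.height 0 ↔
      ‖w‖ ≤ √((1 + B.height 0) / (1 - B.height 0)) := by
  have h1 : 0 < 1 - B.height 0 := sub_pos.2 (B.height_lt_one 0)
  rw [← sub_nonneg, B.height_zero_sub_inner_stereoInv hb2,
    mul_nonneg_iff_of_pos_left (by positivity), sub_nonneg,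
    sq_le_sq₀ (norm_nonneg _) (Real.sqrt_nonneg _)]

/-- The stereographic projection of the billiard table from the centre of an obstacle. -/
noncomputable def planarDomain (hb2 : b 2 = B.center 0) (hb3 : b 3 = pole) :
    CircleDomain (Fin m) where
  outer := √((1 + B.height 0) / (1 - B.height 0))
  center j := B.planarCenter b j.succ
  radius j := B.planarRadius b j.succ
  radius_pos j := B.planarRadius_pos (B.inner_center_succ_lt hb2 j)
  separated i j hij := by
    have hi := B.inner_center_succ_lt hb2 i
    have hj := B.inner_center_succ_lt hb2 j
    rw [← dist_eq_norm, ← disjoint_closedBall_closedBall_iff (B.planarRadius_pos hi).le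
      (B.planarRadius_pos hj).le, Set.disjoint_left]
    intro w hwi hwj
    rw [Metric.mem_closedBall, dist_eq_norm, ← not_lt, ← B.inner_stereoInv_lt_iff hb3 hi,
      not_lt] at hwi
    rw [Metric.mem_closedBall, dist_eq_norm, ← not_lt, ← B.inner_stereoInv_lt_iff hb3 hj] at hwj
    exact hwj (B.inner_lt_height (fun h => hij (Fin.succ_injective m h))
      (stereoInv_mem_sphereTwo b hb3 w) hwi)
  inside i := by
    have hi := B.inner_center_succ_lt hb2 i
    refine norm_add_lt_of_closedBall_subset (B.planarRadius_pos hi).le fun w hw => ?_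
    rw [← not_lt, ← B.inner_stereoInv_lt_iff hb3 hi, not_lt] at hw
    rw [← B.inner_stereoInv_zero_lt_iff hb2]
    exact B.inner_lt_height (Fin.succ_ne_zero i) (stereoInv_mem_sphereTwo b hb3 w) hw
  outer_pos := B.planarOuter_pos

lemma isDefiningFunction_tableFunction {δ : ℝ} (hδ : B.IsMargin δ) (hb2 : b 2 = B.center 0)
    (hb3 : b 3 = pole) : (B.planarDomain hb2 hb3).IsDefiningFunction
      fun w => B.tableFunction δ (stereoInv b w) := by
  intro w
  have hz := stereoInv_mem_sphereTwo b hb3 w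
  dsimp only
  rw [B.tableFunction_pos_iff hδ hz, B.tableFunction_nonneg_iff hδ hz, Fin.forall_fin_succ,
    Fin.forall_fin_succ, B.inner_stereoInv_zero_lt_iff hb2, B.inner_stereoInv_zero_le_iff hb2]
  exact ⟨and_congr_right fun _ => forall_congr' fun j =>
    B.inner_stereoInv_lt_iff hb3 (B.inner_center_succ_lt hb2 j) w,
    and_congr_right fun _ => forall_congr' fun j =>
    B.inner_stereoInv_le_iff hb3 (B.inner_center_succ_lt hb2 j) w⟩

/-- Obstacle `0` becomes the outside of the planar domain and the remaining `m` become its holes, so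
the comparison is with the standard domain with `m` holes. -/
theorem hasGenus_doubleSurface {δ : ℝ} (hδ : B.IsMargin δ) : HasGenus (B.doubleSurface δ) m := by
  obtain ⟨b, hb2, hb3⟩ := exists_adapted_basis (B.center_mem 0)
  have h2 : ∀ z ∈ B.domain, ⟪z, b 2⟫ < 1 := fun z hz => by
    rw [hb2]
    exact ((B.mem_domain_iff.1 hz).2 0).trans_lt (B.height_lt_one 0)
  obtain ⟨e⟩ := CircleDomain.nonempty_homeomorph_double
    (B.isDefiningFunction_tableFunction hδ hb2 hb3) (isDefiningFunction_standardFunction m)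
    ((B.contDiff_tableFunction δ).continuous.comp (continuous_stereoInv b))
    (continuous_standardFunction m)
  exact ⟨(B.doubleSurfaceHomeomorph b hδ hb3 h2).trans (e.trans (standardSurfaceHomeomorph m))⟩

end genus

end SphericalBilliard

theorem theorem4 (n : ℕ) (hn : 1 ≤ n) (B : SphericalBilliard n) :
    ∃ S : Set E4,
      IsSmoothSurface S ∧
      HasGenus S (n - 1) ∧
      (∀ x ∈ S, x ≠ pole ∧ x ≠ -pole) ∧
      sphereProj '' S = B.domain ∧
      B.Transversality S ∧
      B.NonzeroVerticalCurvature S ∧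
      B.Symmetry S := by
  -- At least one obstacle is needed, as the centre of the stereographic projection; the other `m =
  -- n - 1` account for the genus.
  obtain ⟨m, rfl⟩ := Nat.exists_eq_add_of_le' hn
  obtain ⟨δ, hδ⟩ := B.exists_isMargin
  exact ⟨B.doubleSurface δ, B.isSmoothSurface_doubleSurface hδ, B.hasGenus_doubleSurface hδ,
    fun x hx => B.ne_pole_of_mem_doubleSurface hx, B.sphereProj_image_doubleSurface hδ,
    B.transversality_doubleSurface hδ, B.nonzeroVerticalCurvature_doubleSurface hδ,
    B.symmetry_doubleSurface hδ⟩
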